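/- Let $n\ge 1$, $R>0$, $\rho_l,\rho_r\ge 0$ and let $u_l,u_r\in\mathbb R$ be arbitrary. Consider, for $r>0$, $t>0$, the radially symmetric pressureless Euler system in $n$ space dimensions $$\partial_t\rho+\partial_r(\rho u)+\tfrac{n-1}{r}\rho u=0,\qquad \partial_t(\rho u)+\partial_r(\rho u^2)+\tfrac{n-1}{r}\rho u^2=0 \tag{1}$$ with the pseudo-Riemann initial data $$(\rho^0,u^0)(r)=(\rho_l r^{1-n},u_l)\ \ (r<R),\qquad (\rho^0,u^0)(r)=(\rho_r r^{1-n},u_r)\ \ (r>R).$$ **Shadow waves.** The candidates consist of a regular part $(\rho,u)(r,t)$, a position $R+c(t)>0$, a mass density $\sigma(t)$ and a velocity $v(t)$ of the wave for $0\le t<T$, where $0<T\le\infty$ and $c(0)=0$, and a mass $m_0(t)$ at the origin. The approximating family $(\rho^\varepsilon,u^\varepsilon)$ equals $(\sigma(t)/\varepsilon,\,v(t))$ where $0\le t<T$ and $|r-R-c(t)|<\varepsilon/2$, and equals $(\rho,u)$ elsewhere. Such an object is a *global radially symmetric shadow wave solution* if: * $v=\dot c$, and $\sigma,v$ are continuous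 on $[0,T)$; $(\rho,u)$ is a weak solution of (1) on each of the regions $\{0<r<R+c(t),\ 0<t<T\}$ and $\{r>0,\ t>0,\ r>R+c(t)\text{ if }t<T\}$ (test functions with compact support in the region). For all $t\in(0,T)$ outside a locally finite set (interaction times), $\sigma$ and $v$ are $C^1$ near $t$, the regular part agrees near $(R+c(t),t)$ with $C^1$ states $(\rho_0,u_0)$ on the inner side and $(\rho_1,u_1)$ on the outer side of the wave, and, writing $[\cdot]$ for outer minus inner value at $r=R+c(t)$, $$\dot\sigma+\tfrac{n-1}{R+c}\sigma v=\dot c[\rho]-[\rho u],\qquad (\sigma v)^{\boldsymbol\cdot}+\tfrac{n-1}{R+c}\sigma v^2=\dot c[\rho u]-[\rho u^2].$$ Moreover $(\rho^\varepsilon,u^\varepsilon)$ satisfies (1) on $\{r>0,t>0\}$ in the weak limit $\varepsilon\downarrow0$, i.e. the left-hand sides of (1), applied to any test function with compact support in $\{r>0,t>0\}$, tend to $0$. * For all $t>0$ outside a locally finite set the limits $u(0+,t)$ and $\lim_{r\downarrow0}r^{n-1}\rho(r,t)$ exist, and: if $u(0+,t)>0$ then $\dot m_0(t)=0$ and $\rho(0+,t)=0$;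 if $u(0+,t)\le0$ then $\dot m_0(t)=-\lim_{r\downarrow 0}r^{n-1}|\mathbb S^{n-1}|\rho(r,t)u(r,t)$. The function $m_0$ is continuous on $[0,\infty)\setminus\{T\}$. If $T<\infty$, then $R+c(t)\to0$ as $t\uparrow T$, and $m_0(T+)=m_0(T-)+\lim_{t\uparrow T}\sigma(t)(R+c(t))^{n-1}|\mathbb S^{n-1}|$. It *attains the initial data* if $m_0(0)=0$ and, for all sufficiently small $t\ge 0$, the distributional limits on $\{r>0\}$ of $\rho^\varepsilon(\cdot,t)$, $u^\varepsilon(\cdot,t)$, $\rho^\varepsilon u^\varepsilon(\cdot,t)$ as $\varepsilon\downarrow0$ exist, are equal to $\rho^0,u^0,\rho^0u^0$ at $t=0$, and converge to them in the sense of distributions as $t\downarrow0$. It is *physical* if $\sigma$, $\rho$ and $m_0$ are nonnegative. It is *dissipative* if $$\lim_{\varepsilon\downarrow0}\Big(\partial_t\big(\tfrac12\rho^\varepsilon(u^\varepsilon)^2\big)+\partial_r\big(\tfrac12\rho^\varepsilon(u^\varepsilon)^3\big)+\tfrac{n-1}{2r}\rho^\varepsilon(u^\varepsilon)^3\Big)\le0$$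 when applied to any nonnegative test function with compact support in $\{r>0,t>0\}$ (the limit being required to exist). **Proposition.** There is a global, physical and dissipative radially symmetric shadow wave solution that attains the pseudo-Riemann data. At each time $t>0$ it consists of at most one shadow wave (the sphere $r=R+c(t)$, when $\sigma(t)>0$), at most one contact discontinuity, at most three shocks bounding vacuum states, and a point mass $m_0(t)$ at the origin; that is, every other point $(r,t)$ with $r>0$ has a neighbourhood in which the regular part is either vacuum ($\rho=0$, with arbitrary velocity) or a $C^1$ solution of (1). Here a contact discontinuity is a $C^1$ front with $C^1$ states on both sides, positive and different densities on the two sides, and both velocities equal to the speed of the front; a shock bounding a vacuum state is a $C^1$ front with $C^1$ states on both sides, vacuum on one side, positive density on the other, and speed equal to the velocity on the latter side. -/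

import Mathlib

open Set Filter Topology MeasureTheory

noncomputable section

namespace RadialEuler

/-- The surface area of the unit sphere of `ℝⁿ`. -/
def sphereArea (n : ℕ) : ℝ :=
  (volume : Measure (EuclideanSpace ℝ (Fin n))).toSphere.real univ

/-- Partial derivative in the radius `r`; points are `p = (r, t)`. -/
def dr (f : ℝ × ℝ → ℝ) (p : ℝ × ℝ) : ℝ := fderiv ℝ f p (1, 0)

/-- Partial derivative in the time `t`; points are `p = (r, t)`. -/
def dt (f : ℝ × ℝ → ℝ) (p : ℝ × ℝ) : ℝ := fderiv ℝ f p (0, 1)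

/-- The open quarter plane `r > 0`, `t > 0`. -/
def quadrant : Set (ℝ × ℝ) := Ioi 0 ×ˢ Ioi 0

/-- Test functions with compact support in `Ω`. -/
def IsTestOn {E : Type*} [NormedAddCommGroup E] [NormedSpace ℝ E] (Ω : Set E) (φ : E → ℝ) :
    Prop :=
  ContDiff ℝ (⊤ : ℕ∞) φ ∧ HasCompactSupport φ ∧ tsupport φ ⊆ Ω

/-- A set of times with no finite accumulation point. -/
def LocallyFiniteTimes (F : Set ℝ) : Prop := ∀ a b : ℝ, (F ∩ Icc a b).Finite

/-- The integrand of the weak form of `∂ₜ q + ∂ᵣ f + (n - 1) / r * f` tested against `φ`. -/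
def weakIntegrand (n : ℕ) (q f φ : ℝ × ℝ → ℝ) (p : ℝ × ℝ) : ℝ :=
  -(q p * dt φ p) - f p * dr φ p + ((n : ℝ) - 1) / p.1 * f p * φ p

/-- `∂ₜ q + ∂ᵣ f + (n - 1) / r * f = 0` in the weak sense on the set `Ω` of the quarter plane. -/
def WeakEqOn (n : ℕ) (Ω : Set (ℝ × ℝ)) (q f : ℝ × ℝ → ℝ) : Prop :=
  ∀ φ : ℝ × ℝ → ℝ, IsTestOn Ω φ →
    IntegrableOn (weakIntegrand n q f φ) quadrant ∧
      ∫ p in quadrant, weakIntegrand n q f φ p = 0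

/-- `(ρ, u)` is a weak solution on `Ω` of the radial pressureless Euler system. -/
def IsWeakSolutionOn (n : ℕ) (Ω : Set (ℝ × ℝ)) (ρ u : ℝ × ℝ → ℝ) : Prop :=
  WeakEqOn n Ω ρ (fun p => ρ p * u p) ∧
    WeakEqOn n Ω (fun p => ρ p * u p) (fun p => ρ p * u p ^ 2)

/-- As `ε ↓ 0`, the expression `∂ₜ q^ε + ∂ᵣ f^ε + (n - 1) / r * f^ε`, applied to the test function
`φ`, converges to `L`. -/
def WeakLimit (n : ℕ) (q f : ℝ → ℝ × ℝ → ℝ) (φ : ℝ × ℝ → ℝ) (L : ℝ) : Prop :=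
  (∀ᶠ ε in 𝓝[>] (0 : ℝ), IntegrableOn (weakIntegrand n (q ε) (f ε) φ) quadrant) ∧
    Tendsto (fun ε => ∫ p in quadrant, weakIntegrand n (q ε) (f ε) φ p) (𝓝[>] 0) (𝓝 L)

/-- Near the point `(γ t, t)`, the pair `(ρ, u)` agrees with the `C¹` pair `(ρ₀, u₀)` on the left
of the curve `r = γ(t)` and with the `C¹` pair `(ρ₁, u₁)` on its right. -/
def HasSides (ρ u : ℝ × ℝ → ℝ) (γ : ℝ → ℝ) (t : ℝ) (ρ₀ u₀ ρ₁ u₁ : ℝ × ℝ → ℝ) : Prop :=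
  ContDiffAt ℝ 1 ρ₀ (γ t, t) ∧ ContDiffAt ℝ 1 u₀ (γ t, t) ∧
  ContDiffAt ℝ 1 ρ₁ (γ t, t) ∧ ContDiffAt ℝ 1 u₁ (γ t, t) ∧
  ∀ᶠ p in 𝓝 (γ t, t),
    (p.1 < γ p.2 → ρ p = ρ₀ p ∧ u p = u₀ p) ∧ (γ p.2 < p.1 → ρ p = ρ₁ p ∧ u p = u₁ p)

/-- Near `p`, the state is a vacuum (with arbitrary velocity) or a classical solution of the radial
pressureless Euler system. -/
def IsClassicalAt (n : ℕ) (ρ u : ℝ × ℝ → ℝ) (p : ℝ × ℝ) : Prop :=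
  (∀ᶠ q in 𝓝 p, ρ q = 0) ∨
  (ContDiffAt ℝ 1 ρ p ∧ ContDiffAt ℝ 1 u p ∧
    ∀ᶠ q in 𝓝 p,
      dt ρ q + dr (fun z => ρ z * u z) q + ((n : ℝ) - 1) / q.1 * (ρ q * u q) = 0 ∧
      dt (fun z => ρ z * u z) q + dr (fun z => ρ z * u z ^ 2) q
        + ((n : ℝ) - 1) / q.1 * (ρ q * u q ^ 2) = 0)

/-- A contact discontinuity passes through `(r, t)`: there is matter on both sides, the density
jumps, and the velocities on both sides are the velocity of the front. -/
def IsContactAt (ρ u : ℝ × ℝ → ℝ) (r t : ℝ) : Prop :=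
  ∃ (γ : ℝ → ℝ) (ρ₀ u₀ ρ₁ u₁ : ℝ × ℝ → ℝ),
    ContDiffAt ℝ 1 γ t ∧ γ t = r ∧ HasSides ρ u γ t ρ₀ u₀ ρ₁ u₁ ∧
    0 < ρ₀ (r, t) ∧ 0 < ρ₁ (r, t) ∧ ρ₀ (r, t) ≠ ρ₁ (r, t) ∧
    ∀ᶠ s in 𝓝 t, u₀ (γ s, s) = deriv γ s ∧ u₁ (γ s, s) = deriv γ s

/-- A shock bounding a vacuum passes through `(r, t)`: there is vacuum on exactly one side, and the
velocity on the other side is the velocity of the front. -/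
def IsVacuumShockAt (ρ u : ℝ × ℝ → ℝ) (r t : ℝ) : Prop :=
  ∃ (γ : ℝ → ℝ) (ρ₀ u₀ ρ₁ u₁ : ℝ × ℝ → ℝ),
    ContDiffAt ℝ 1 γ t ∧ γ t = r ∧ HasSides ρ u γ t ρ₀ u₀ ρ₁ u₁ ∧
    (((∀ᶠ p in 𝓝 (r, t), ρ₀ p = 0) ∧ 0 < ρ₁ (r, t) ∧
        ∀ᶠ s in 𝓝 t, u₁ (γ s, s) = deriv γ s) ∨
     ((∀ᶠ p in 𝓝 (r, t), ρ₁ p = 0) ∧ 0 < ρ₀ (r, t) ∧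
        ∀ᶠ s in 𝓝 t, u₀ (γ s, s) = deriv γ s))

/-- The data of a shadow wave with mass at the origin. The regular part is `(ρ, u)`; the shadow
wave starts on the sphere of radius `R`, is located at `r = R + c(t)` for `0 ≤ t < T`, and carries
the mass density `σ(t)` with velocity `v(t)`; the mass at the origin is `m₀(t)`. -/
structure ShadowWave where
  ρ : ℝ × ℝ → ℝ
  u : ℝ × ℝ → ℝ
  c : ℝ → ℝ
  σ : ℝ → ℝ
  v : ℝ → ℝ
  T : EReal
  m₀ : ℝ → ℝ

namespace ShadowWave

variable (S : ShadowWave)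

/-- The times at which the shadow wave is present. -/
def life : Set ℝ := {t | 0 ≤ t ∧ (t : EReal) < S.T}

open Classical in
/-- The density of the approximating family. -/
def ρSW (R ε : ℝ) (p : ℝ × ℝ) : ℝ :=
  if p.2 ∈ S.life ∧ |p.1 - (R + S.c p.2)| < ε / 2 then S.σ p.2 / ε else S.ρ p

open Classical in
/-- The velocity of the approximating family. -/
def uSW (R ε : ℝ) (p : ℝ × ℝ) : ℝ :=
  if p.2 ∈ S.life ∧ |p.1 - (R + S.c p.2)| < ε / 2 then S.v p.2 else S.u p

/-- The region on the inner side of the shadow wave. -/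
def leftRegion (R : ℝ) : Set (ℝ × ℝ) :=
  {p | 0 < p.1 ∧ 0 < p.2 ∧ (p.2 : EReal) < S.T ∧ p.1 < R + S.c p.2}

/-- The region on the outer side of the shadow wave; it is everything once the wave has been
absorbed at the origin. -/
def rightRegion (R : ℝ) : Set (ℝ × ℝ) :=
  {p | 0 < p.1 ∧ 0 < p.2 ∧ ((p.2 : EReal) < S.T → R + S.c p.2 < p.1)}

/-- At time `t` the position, mass and velocity of the wave are related to the states on its two
sides by `σ' + (n - 1) / (R + c) * σ v = κ₁` and `(σ v)' + (n - 1) / (R + c) * σ v² = κ₂`. -/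
def BalanceAt (n : ℕ) (R t : ℝ) : Prop :=
  ∃ ρ₀ u₀ ρ₁ u₁ : ℝ × ℝ → ℝ,
    HasSides S.ρ S.u (fun s => R + S.c s) t ρ₀ u₀ ρ₁ u₁ ∧
    ContDiffAt ℝ 1 S.σ t ∧ ContDiffAt ℝ 1 S.v t ∧
    let x : ℝ := R + S.c t
    let a₀ := ρ₀ (x, t)
    let w₀ := u₀ (x, t)
    let a₁ := ρ₁ (x, t)
    let w₁ := u₁ (x, t)
    deriv S.σ t + ((n : ℝ) - 1) / x * (S.σ t * S.v t)
        = deriv S.c t * (a₁ - a₀) - (a₁ * w₁ - a₀ * w₀) ∧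
    deriv (fun s => S.σ s * S.v s) t + ((n : ℝ) - 1) / x * (S.σ t * S.v t ^ 2)
        = deriv S.c t * (a₁ * w₁ - a₀ * w₀) - (a₁ * w₁ ^ 2 - a₀ * w₀ ^ 2)

/-- Shadow wave solution away from the origin. The balance laws of the wave hold pointwise, except
at isolated times where it interacts with another front; the conservation laws are satisfied by
the whole family in the weak limit `ε ↓ 0`, in particular across such times. -/
structure IsSolutionAwayFromOrigin (n : ℕ) (R : ℝ) : Prop where
  lifetime_pos : 0 < S.T
  start : S.c 0 = 0
  position_pos : ∀ t ∈ S.life, 0 < R + S.c t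
  velocity : ∀ t ∈ S.life, HasDerivWithinAt S.c (S.v t) (Ici 0) t
  velocity_cont : ContinuousOn S.v S.life
  mass_cont : ContinuousOn S.σ S.life
  left : IsWeakSolutionOn n (S.leftRegion R) S.ρ S.u
  right : IsWeakSolutionOn n (S.rightRegion R) S.ρ S.u
  balance : ∃ F : Set ℝ, LocallyFiniteTimes F ∧
    ∀ t ∈ S.life, 0 < t → t ∉ F → S.BalanceAt n R t
  weak_mass : ∀ φ, IsTestOn quadrant φ →
    WeakLimit n (fun ε => S.ρSW R ε) (fun ε p => S.ρSW R ε p * S.uSW R ε p) φ 0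
  weak_momentum : ∀ φ, IsTestOn quadrant φ →
    WeakLimit n (fun ε p => S.ρSW R ε p * S.uSW R ε p)
      (fun ε p => S.ρSW R ε p * S.uSW R ε p ^ 2) φ 0

/-- The limits at the origin exist and the boundary conditions hold at time `t`. -/
def BoundaryConditionAt (n : ℕ) (t : ℝ) : Prop :=
  ∃ a b : ℝ,
    Tendsto (fun r => S.u (r, t)) (𝓝[>] 0) (𝓝 a) ∧
    Tendsto (fun r => S.ρ (r, t) * r ^ ((n : ℤ) - 1)) (𝓝[>] 0) (𝓝 b) ∧
    (0 < a → HasDerivAt S.m₀ 0 t ∧ Tendsto (fun r => S.ρ (r, t)) (𝓝[>] 0) (𝓝 0)) ∧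
    (a ≤ 0 → ∃ l : ℝ,
      Tendsto (fun r => r ^ ((n : ℤ) - 1) * sphereArea n * S.ρ (r, t) * S.u (r, t))
        (𝓝[>] 0) (𝓝 l) ∧
      HasDerivAt S.m₀ (-l) t)

/-- The wave disappears at a finite time only by reaching the origin, where its mass is then added
to the mass at the origin. -/
def AbsorbedAt (n : ℕ) (R t₀ : ℝ) : Prop :=
  Tendsto (fun t => R + S.c t) (𝓝[<] t₀) (𝓝 0) ∧
  ∃ m d : ℝ,
    Tendsto S.m₀ (𝓝[<] t₀) (𝓝 m) ∧
    Tendsto (fun t => S.σ t * (R + S.c t) ^ ((n : ℤ) - 1) * sphereArea n) (𝓝[<] t₀) (𝓝 d) ∧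
    Tendsto S.m₀ (𝓝[>] t₀) (𝓝 (m + d))

/-- Global radially symmetric shadow wave solution, for all times `t > 0`, including the boundary
conditions at the origin. -/
structure IsRadialSolution (n : ℕ) (R : ℝ) : Prop where
  away : S.IsSolutionAwayFromOrigin n R
  boundary : ∃ F : Set ℝ, LocallyFiniteTimes F ∧
    ∀ t, 0 < t → t ∉ F → S.BoundaryConditionAt n t
  origin_cont : ContinuousOn S.m₀ {t | 0 ≤ t ∧ (t : EReal) ≠ S.T}
  absorbed : ∀ t₀ : ℝ, (t₀ : EReal) = S.T → S.AbsorbedAt n R t₀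

/-- `g^ε(·, t)` has a distributional limit on `r > 0` as `ε ↓ 0`, for all small `t ≥ 0`, and these
limits attain the value `g⁰` at `t = 0`, continuously as `t ↓ 0`. -/
def AttainsInitially (g : ℝ → ℝ × ℝ → ℝ) (g₀ : ℝ → ℝ) : Prop :=
  ∀ ψ : ℝ → ℝ, IsTestOn (Ioi 0) ψ →
    IntegrableOn (fun r => g₀ r * ψ r) (Ioi 0) ∧
    ∃ M : ℝ → ℝ,
      (∀ᶠ t in 𝓝[≥] (0 : ℝ),
        (∀ᶠ ε in 𝓝[>] (0 : ℝ), IntegrableOn (fun r => g ε (r, t) * ψ r) (Ioi 0)) ∧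
        Tendsto (fun ε => ∫ r in Ioi 0, g ε (r, t) * ψ r) (𝓝[>] 0) (𝓝 (M t))) ∧
      Tendsto M (𝓝[≥] 0) (𝓝 (∫ r in Ioi 0, g₀ r * ψ r))

/-- The initial density `ρ⁰` and velocity `u⁰` (and with them the momentum) are attained, and there
is no mass at the origin initially. -/
structure HasInitialData (R : ℝ) (ρ₀ u₀ : ℝ → ℝ) : Prop where
  density : AttainsInitially (fun ε => S.ρSW R ε) ρ₀
  velocity : AttainsInitially (fun ε => S.uSW R ε) u₀
  momentum : AttainsInitially (fun ε p => S.ρSW R ε p * S.uSW R ε p) (fun r => ρ₀ r * u₀ r)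
  origin : S.m₀ 0 = 0

/-- All masses are nonnegative. -/
structure IsPhysical : Prop where
  wave : ∀ t ∈ S.life, 0 ≤ S.σ t
  regular : ∀ r t, 0 < r → 0 ≤ t → 0 ≤ S.ρ (r, t)
  origin : ∀ t, 0 ≤ t → 0 ≤ S.m₀ t

/-- The kinetic energy inequality holds in the weak limit `ε ↓ 0`. -/
def IsDissipative (n : ℕ) (R : ℝ) : Prop :=
  ∀ φ, IsTestOn quadrant φ → (∀ p, 0 ≤ φ p) →
    ∃ L ≤ 0, WeakLimit n (fun ε p => 1 / 2 * S.ρSW R ε p * S.uSW R ε p ^ 2)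
      (fun ε p => 1 / 2 * S.ρSW R ε p * S.uSW R ε p ^ 3) φ L

/-- At time `t` and away from the origin, the solution consists of classical or vacuum states
separated by at most one shadow wave (the one on `r = R + c(t)`, when it carries mass), at most
`contacts` contact discontinuities and at most `shocks` shocks bounding vacuum states. -/
def ConsistsOfAtMost (n : ℕ) (R : ℝ) (contacts shocks : ℕ) (t : ℝ) : Prop :=
  ∃ K V : Finset ℝ, K.card ≤ contacts ∧ V.card ≤ shocks ∧
    (∀ r ∈ K, 0 < r ∧ IsContactAt S.ρ S.u r t) ∧
    (∀ r ∈ V, 0 < r ∧ IsVacuumShockAt S.ρ S.u r t) ∧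
    ∀ r, 0 < r → r ∉ K → r ∉ V →
      (t ∈ S.life ∧ r = R + S.c t ∧ 0 < S.σ t) ∨ IsClassicalAt n S.ρ S.u (r, t)

end ShadowWave

/-- Pseudo-Riemann initial density. -/
def initialDensity (n : ℕ) (R ρl ρr r : ℝ) : ℝ :=
  (if r < R then ρl else ρr) * r ^ (1 - (n : ℤ))

/-- Pseudo-Riemann initial velocity. -/
def initialVelocity (R ul ur r : ℝ) : ℝ := if r < R then ul else ur

end RadialEuler

end

noncomputable section

namespace RadialEuler

/-! Write the density as `r ^ (1 - n)` times a plane density. The geometric source term is then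
exactly what the derivative of the weight produces (`weakIntegrand_eq_weighted`), so the radial
system becomes plane pressureless gas dynamics and the data become constant Riemann data. It
therefore suffices to exhibit an explicit plane solution: a particle of mass `m` on a path `X` with
velocity `v`, the right state outside it, the left state between the line `r = ul * t` and `Y`, and
vacuum elsewhere. `Front` collects what is required of it, chiefly that `m` and `m * v` change at
the rates at which the two states run into the particle. A front lives on all times and may pass
through the origin; the radial solution only sees the part `r > 0`.

All weak limits come from one computation, `weakLimit_moment`. The divergence theorem turns the
regular part into a line integral along `X`, and thin strips converge to line integrals, so the
`j`-th moment equation leaves the integral of `(m v ^ j)' - flux j` along the path. For `j = 0, 1`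
this vanishes by the balance laws. For `j = 2` the density is minus a combination of `(v - ur) ^ 3`
and `(ul - v) ^ 3` with nonnegative coefficients, which gives dissipation because `ur ≤ v`, and `v ≤
ul` wherever the particle touches the left state.

Since `v` is nonincreasing, `X` is concave, so it is positive exactly on some `[0, T)`. The plane
state near `r = 0` is constant between finitely many times, which makes the mass at the origin
explicit.

Fronts exist in every case. If `ul ≤ ur`, or if one of the densities is zero, a massless front of
constant speed works. If `ul > ur` and the densities are `a ^ 2` and `b ^ 2` with `a, b > 0`, the
particle first moves with velocity `(a * ul + b * ur) / (a + b)`. Once the matter inside is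
exhausted, `m * (v - ur)` is conserved, so `m ^ 2` is affine in time (`deltaFront`). -/

/-! ### Integrals over thin strips around a curve -/

/-- For continuous functions the fundamental theorem of calculus tolerates countably many points
without derivative. This is needed because mass, velocity and the boundary curves may have kinks at
interaction times. -/
theorem integral_eq_zero_of_hasDerivAt_off_countable {g g' : ℝ → ℝ} {F : Set ℝ} (hF : F.Countable)
    (hg : Continuous g) (hc : HasCompactSupport g) (hd : ∀ t ∉ F, HasDerivAt g (g' t) t)
    (hi : Integrable g') : ∫ t, g' t = 0 := by
  have hlim : Tendsto (fun i : ℝ => ∫ t in (-i)..i, g' t) atTop (𝓝 (∫ t, g' t)) :=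
    intervalIntegral_tendsto_integral hi tendsto_neg_atTop_atBot tendsto_id
  obtain ⟨B, hB⟩ := hc.isCompact.isBounded.subset_closedBall 0
  have hz : ∀ x, B < |x| → g x = 0 := fun x hx => by
    by_contra h
    have := hB (subset_tsupport g h)
    rw [Metric.mem_closedBall, dist_zero_right, Real.norm_eq_abs] at this
    linarith
  refine tendsto_nhds_unique hlim (tendsto_const_nhds.congr' ?_)
  filter_upwards [eventually_gt_atTop (max B 0)] with i hi'
  have h0 : 0 < i := lt_of_le_of_lt (le_max_right _ _) hi'
  have hBi : B < i := lt_of_le_of_lt (le_max_left _ _) hi'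
  rw [integral_eq_of_hasDerivAt_off_countable g g' hF hg.continuousOn
    (fun x hx => hd x hx.2) hi.intervalIntegrable, hz i (by rwa [abs_of_pos h0]),
    hz (-i) (by rwa [abs_neg, abs_of_pos h0]), sub_zero]

theorem strip_eq_Ioo (x ε : ℝ) : {r : ℝ | |r - x| < ε / 2} = Ioo (x - ε / 2) (x + ε / 2) := by
  ext r
  simp only [Set.mem_ofPred_eq, mem_Ioo, abs_lt]
  constructor <;> rintro ⟨h1, h2⟩ <;> constructor <;> linarith

theorem abs_strip_average_le {h : ℝ → ℝ} {x C ε : ℝ} (hε : 0 < ε)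
    (hC : ∀ r, |r - x| < ε / 2 → |h r| ≤ C) :
    |1 / ε * ∫ r in {r | |r - x| < ε / 2}, h r| ≤ C := by
  have := norm_setIntegral_le_of_norm_le_const (μ := volume) (f := h) (C := C)
    (s := {r | |r - x| < ε / 2}) (by rw [strip_eq_Ioo]; simp) (fun r hr => hC r hr)
  rw [strip_eq_Ioo, Real.volume_real_Ioo_of_le (by linarith), ← strip_eq_Ioo] at this
  rw [abs_mul, abs_of_pos (by positivity : 0 < 1 / ε), div_mul_eq_mul_div, one_mul,
    div_le_iff₀ hε]
  refine this.trans (le_of_eq ?_)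
  ring

theorem tendsto_strip_average {h : ℝ → ℝ} (hh : Continuous h) (x : ℝ) :
    Tendsto (fun ε : ℝ => 1 / ε * ∫ r in {r | |r - x| < ε / 2}, h r) (𝓝[>] 0) (𝓝 (h x)) := by
  rw [Metric.tendsto_nhds]
  intro e he
  obtain ⟨δ, hδ, hd⟩ := Metric.continuous_iff.1 hh x (e / 2) (by positivity)
  have : ∀ᶠ ε : ℝ in 𝓝[>] 0, ε < δ := nhdsWithin_le_nhds (Iio_mem_nhds hδ)
  filter_upwards [this, self_mem_nhdsWithin] with ε hεδ hε
  have hε : 0 < ε := hε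
  have key := abs_strip_average_le (h := fun r => h r - h x) (x := x) (C := e / 2) hε
    (fun r hr => by
      have := hd r (by rw [Real.dist_eq]; linarith)
      rw [Real.dist_eq] at this
      exact this.le)
  have hint : IntegrableOn h {r | |r - x| < ε / 2} := by
    rw [strip_eq_Ioo]
    exact (hh.integrableOn_Icc).mono_set Ioo_subset_Icc_self
  rw [integral_sub hint (by rw [strip_eq_Ioo]; simp)] at key
  rw [setIntegral_const, strip_eq_Ioo, Real.volume_real_Ioo_of_le (by linarith), ← strip_eq_Ioo,
    mul_sub] at key
  rw [Real.dist_eq]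
  have e1 : 1 / ε * ((x + ε / 2 - (x - ε / 2)) • h x) = h x := by
    simp only [smul_eq_mul]; field_simp; ring
  rw [e1] at key
  linarith

theorem isOpen_strip {X : ℝ → ℝ} (hX : Continuous X) (ε : ℝ) :
    IsOpen {p : ℝ × ℝ | |p.1 - X p.2| < ε / 2} :=
  isOpen_lt (by fun_prop) continuous_const

theorem exists_compact_times {h : ℝ × ℝ → ℝ} (hc : HasCompactSupport h) :
    ∃ K : Set ℝ, IsCompact K ∧ ∀ r t, t ∉ K → h (r, t) = 0 := by
  refine ⟨Prod.snd '' tsupport h, hc.isCompact.image continuous_snd, fun r t ht => ?_⟩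
  by_contra hne
  exact ht ⟨(r, t), subset_tsupport h hne, rfl⟩

/-- Averages over a thin strip around a curve converge to the integral along the curve. -/
theorem tendsto_strip_integral {h : ℝ × ℝ → ℝ} (hh : Continuous h) (hc : HasCompactSupport h)
    {X : ℝ → ℝ} (hX : Continuous X) :
    Tendsto (fun ε : ℝ => 1 / ε * ∫ p in {p : ℝ × ℝ | |p.1 - X p.2| < ε / 2}, h p) (𝓝[>] 0)
      (𝓝 (∫ t, h (X t, t))) := by
  obtain ⟨C, hC⟩ := hc.exists_bound_of_continuous hh
  obtain ⟨K, hK, hKz⟩ := exists_compact_times hc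
  have hint : Integrable h := hh.integrable_of_hasCompactSupport hc
  have hstrip : ∀ ε, Integrable ({p : ℝ × ℝ | |p.1 - X p.2| < ε / 2}.indicator h)
      (volume.prod volume) := fun ε => hint.indicator (isOpen_strip hX ε).measurableSet
  have heq : ∀ ε, ∫ p in {p : ℝ × ℝ | |p.1 - X p.2| < ε / 2}, h p
      = ∫ t, ∫ r in {r | |r - X t| < ε / 2}, h (r, t) := fun ε => by
    rw [← integral_indicator (isOpen_strip hX ε).measurableSet, Measure.volume_eq_prod,
      integral_prod_symm _ (hstrip ε)]
    refine integral_congr_ae (ae_of_all _ fun t => ?_)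
    dsimp only
    rw [← integral_indicator (by rw [strip_eq_Ioo]; exact measurableSet_Ioo)]
    rfl
  simp_rw [heq]
  have hout : ∀ ε : ℝ, 1 / ε * ∫ t, ∫ r in {r | |r - X t| < ε / 2}, h (r, t)
      = ∫ t, 1 / ε * ∫ r in {r | |r - X t| < ε / 2}, h (r, t) :=
    fun ε => (integral_const_mul _ _).symm
  simp_rw [hout]
  refine tendsto_integral_filter_of_dominated_convergence (K.indicator (fun _ => C)) ?_ ?_ ?_ ?_
  · refine Eventually.of_forall fun ε => AEStronglyMeasurable.const_mul ?_ _
    have := (hstrip ε).integral_prod_right.aestronglyMeasurable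
    refine this.congr (ae_of_all _ fun t => ?_)
    dsimp only
    rw [← integral_indicator (by rw [strip_eq_Ioo]; exact measurableSet_Ioo)]
    rfl
  · filter_upwards [self_mem_nhdsWithin] with ε hε
    refine ae_of_all _ fun t => ?_
    by_cases ht : t ∈ K
    · rw [indicator_of_mem ht]
      exact abs_strip_average_le hε fun r _ => hC (r, t)
    · simp [indicator_of_notMem ht, hKz _ t ht]
  · rw [integrable_indicator_iff hK.measurableSet]
    exact integrableOn_const hK.measure_lt_top.ne
  · exact ae_of_all _ fun t => tendsto_strip_average (h := fun r => h (r, t)) (by fun_prop) (X t)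

/-! ### Divergence theorem on one side of a curve -/

/-- Shearing of the plane along a curve. -/
def shear {γ : ℝ → ℝ} (hγ : Continuous γ) : ℝ × ℝ ≃ₜ ℝ × ℝ where
  toFun p := (p.1 + γ p.2, p.2)
  invFun p := (p.1 - γ p.2, p.2)
  left_inv p := by simp
  right_inv p := by simp
  continuous_toFun := by fun_prop
  continuous_invFun := by fun_prop

section Regular

variable {ψ : ℝ × ℝ → ℝ}

theorem hasDerivAt_along_curve (hψ : ContDiff ℝ 1 ψ) {γ : ℝ → ℝ} {γ' t : ℝ}
    (hγ : HasDerivAt γ γ' t) (s : ℝ) :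
    HasDerivAt (fun t => ψ (s + γ t, t)) (dt ψ (s + γ t, t) + γ' * dr ψ (s + γ t, t)) t := by
  have h1 : HasDerivAt (fun t => (s + γ t, t)) (γ', (1 : ℝ)) t :=
    (hγ.const_add s).prodMk (hasDerivAt_id t)
  have h2 := ((hψ.differentiable one_ne_zero) (s + γ t, t)).hasFDerivAt.comp_hasDerivAt (f := fun t => (s + γ t, t)) t h1
  have e : ((γ', 1) : ℝ × ℝ) = (0, 1) + γ' • (1, 0) := by simp
  rw [e, map_add, map_smul] at h2
  exact h2

theorem continuous_dt (hψ : ContDiff ℝ 1 ψ) : Continuous (dt ψ) :=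
  (hψ.continuous_fderiv one_ne_zero).clm_apply continuous_const

theorem continuous_dr (hψ : ContDiff ℝ 1 ψ) : Continuous (dr ψ) :=
  (hψ.continuous_fderiv one_ne_zero).clm_apply continuous_const

theorem hasCompactSupport_dt (hc : HasCompactSupport ψ) : HasCompactSupport (dt ψ) :=
  (hc.fderiv ℝ).comp_left (g := fun L : ℝ × ℝ →L[ℝ] ℝ => L (0, 1)) rfl

theorem hasCompactSupport_dr (hc : HasCompactSupport ψ) : HasCompactSupport (dr ψ) :=
  (hc.fderiv ℝ).comp_left (g := fun L : ℝ × ℝ →L[ℝ] ℝ => L (1, 0)) rfl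

theorem integrable_dt (hψ : ContDiff ℝ 1 ψ) (hc : HasCompactSupport ψ) : Integrable (dt ψ) :=
  (continuous_dt hψ).integrable_of_hasCompactSupport (hasCompactSupport_dt hc)

theorem integrable_dr (hψ : ContDiff ℝ 1 ψ) (hc : HasCompactSupport ψ) : Integrable (dr ψ) :=
  (continuous_dr hψ).integrable_of_hasCompactSupport (hasCompactSupport_dr hc)

theorem integrable_snd_mul {g : ℝ × ℝ → ℝ} (hg : Integrable g) {k : ℝ → ℝ} (hk : Measurable k)
    {C : ℝ} (hC : ∀ t, |k t| ≤ C) : Integrable (fun p : ℝ × ℝ => k p.2 * g p) :=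
  hg.bdd_mul (hk.comp measurable_snd).aestronglyMeasurable (ae_of_all _ fun p => hC p.2)

theorem integrable_material_derivative (hψ : ContDiff ℝ 1 ψ) (hc : HasCompactSupport ψ)
    {k : ℝ → ℝ} (hk : Measurable k) {C : ℝ} (hC : ∀ t, |k t| ≤ C) :
    Integrable (fun p : ℝ × ℝ => dt ψ p + k p.2 * dr ψ p) :=
  (integrable_dt hψ hc).add (integrable_snd_mul (integrable_dr hψ hc) hk hC)

theorem isOpen_right {γ : ℝ → ℝ} (hγ : Continuous γ) : IsOpen {p : ℝ × ℝ | γ p.2 < p.1} :=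
  isOpen_lt (by fun_prop) continuous_fst

theorem setIntegral_right_eq {γ : ℝ → ℝ} (hγ : Continuous γ) {g : ℝ × ℝ → ℝ}
    (hg : Integrable g) :
    ∫ p in {p : ℝ × ℝ | γ p.2 < p.1}, g p = ∫ t, ∫ r in Ioi (γ t), g (r, t) := by
  rw [← integral_indicator (isOpen_right hγ).measurableSet, Measure.volume_eq_prod,
    integral_prod_symm _ (hg.indicator (isOpen_right hγ).measurableSet)]
  refine integral_congr_ae (ae_of_all _ fun t => ?_)
  dsimp only
  rw [← integral_indicator measurableSet_Ioi]
  rfl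

theorem hasCompactSupport_along_curve (hc : HasCompactSupport ψ) {γ : ℝ → ℝ} (s : ℝ) :
    HasCompactSupport (fun t => ψ (s + γ t, t)) := by
  obtain ⟨K, hK, hKz⟩ := exists_compact_times hc
  exact HasCompactSupport.intro hK fun t ht => hKz _ t ht

/-- In the coordinates `(s, t)` with `r = s + γ t` the region is the fixed half-plane `s > 0` and
the integrand is the time derivative of `ψ (s + γ t, t)`. After Fubini, the integral over `t`
vanishes for each `s`. -/
theorem integral_right_material_derivative (hψ : ContDiff ℝ 1 ψ) (hc : HasCompactSupport ψ)
    {γ γ' : ℝ → ℝ} (hγ : Continuous γ) (hγ'm : Measurable γ') {C : ℝ} (hC : ∀ t, |γ' t| ≤ C)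
    {F : Set ℝ} (hF : F.Countable) (hd : ∀ t ∉ F, HasDerivAt γ (γ' t) t) :
    ∫ p in {p : ℝ × ℝ | γ p.2 < p.1}, (dt ψ p + γ' p.2 * dr ψ p) = 0 := by
  rw [setIntegral_right_eq hγ (integrable_material_derivative hψ hc hγ'm hC)]
  have hshift : ∀ t, ∫ r in Ioi (γ t), (dt ψ (r, t) + γ' t * dr ψ (r, t))
      = ∫ s in Ioi (0 : ℝ), (dt ψ (s + γ t, t) + γ' t * dr ψ (s + γ t, t)) := fun t => by
    rw [← integral_indicator measurableSet_Ioi, ← integral_indicator measurableSet_Ioi,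
      ← integral_add_right_eq_self _ (γ t)]
    refine integral_congr_ae (ae_of_all _ fun s => ?_)
    simp [indicator]
  simp_rw [hshift]
  have hcont1 : Continuous (fun p : ℝ × ℝ => dt ψ (p.1 + γ p.2, p.2)) :=
    (continuous_dt hψ).comp (shear hγ).continuous
  have hcont2 : Continuous (fun p : ℝ × ℝ => dr ψ (p.1 + γ p.2, p.2)) :=
    (continuous_dr hψ).comp (shear hγ).continuous
  have hi1 : Integrable (fun p : ℝ × ℝ => dt ψ (p.1 + γ p.2, p.2)) :=
    hcont1.integrable_of_hasCompactSupport
      ((hasCompactSupport_dt hc).comp_isClosedEmbedding (shear hγ).isClosedEmbedding)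
  have hi2 : Integrable (fun p : ℝ × ℝ => dr ψ (p.1 + γ p.2, p.2)) :=
    hcont2.integrable_of_hasCompactSupport
      ((hasCompactSupport_dr hc).comp_isClosedEmbedding (shear hγ).isClosedEmbedding)
  have hi : Integrable (fun p : ℝ × ℝ => dt ψ (p.1 + γ p.2, p.2)
      + γ' p.2 * dr ψ (p.1 + γ p.2, p.2)) := hi1.add (integrable_snd_mul hi2 hγ'm hC)
  have hi' : Integrable (Function.uncurry fun t s => dt ψ (s + γ t, t)
      + γ' t * dr ψ (s + γ t, t)) (volume.prod (volume.restrict (Ioi (0 : ℝ)))) := by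
    have h1 : Integrable (fun p : ℝ × ℝ => dt ψ (p.2 + γ p.1, p.1)
      + γ' p.1 * dr ψ (p.2 + γ p.1, p.1)) (volume.prod volume) := hi.swap
    have h2 := h1.restrict (s := univ ×ˢ Ioi (0 : ℝ))
    rwa [← Measure.prod_restrict, Measure.restrict_univ] at h2
  rw [integral_integral_swap hi']
  refine (integral_congr_ae (ae_of_all _ fun s => ?_)).trans (integral_zero _ _)
  refine integral_eq_zero_of_hasDerivAt_off_countable hF (g := fun t => ψ (s + γ t, t)) ?_
    (hasCompactSupport_along_curve hc s) (fun t ht => hasDerivAt_along_curve hψ (hd t ht) s) ?_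
  · exact hψ.continuous.comp (by fun_prop)
  · refine Integrable.add ?_ (Integrable.bdd_mul (c := C) ?_ hγ'm.aestronglyMeasurable
      (ae_of_all _ hC))
    · exact (hcont1.comp (by fun_prop : Continuous fun t => (s, t))).integrable_of_hasCompactSupport
        (hasCompactSupport_along_curve (hasCompactSupport_dt hc) s)
    · exact (hcont2.comp (by fun_prop : Continuous fun t => (s, t))).integrable_of_hasCompactSupport
        (hasCompactSupport_along_curve (hasCompactSupport_dr hc) s)

/-- Divergence theorem for a constant field on the right of a curve. -/
theorem integral_right_of_curve (hψ : ContDiff ℝ 1 ψ) (hc : HasCompactSupport ψ)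
    {γ γ' : ℝ → ℝ} (hγ : Continuous γ) (hγ'm : Measurable γ') {C : ℝ} (hC : ∀ t, |γ' t| ≤ C)
    {F : Set ℝ} (hF : F.Countable) (hd : ∀ t ∉ F, HasDerivAt γ (γ' t) t) (a b : ℝ) :
    ∫ p in {p : ℝ × ℝ | γ p.2 < p.1}, (a * dt ψ p + b * dr ψ p)
      = ∫ t, (a * γ' t - b) * ψ (γ t, t) := by
  have hi1 := integrable_material_derivative hψ hc hγ'm hC
  have hi2 : Integrable (fun p : ℝ × ℝ => (b - a * γ' p.2) * dr ψ p) := by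
    refine integrable_snd_mul (integrable_dr hψ hc) (k := fun t => b - a * γ' t) (by fun_prop)
      (C := |b| + |a| * C) fun t => (abs_sub _ _).trans ?_
    rw [abs_mul]
    gcongr
    exact hC t
  -- The field is split into a part tangent to the curve, which contributes nothing, and a purely
  -- radial part, which is integrated in `r` down to the curve.
  have hsplit : ∫ p in {p : ℝ × ℝ | γ p.2 < p.1}, (a * dt ψ p + b * dr ψ p)
      = ∫ p in {p : ℝ × ℝ | γ p.2 < p.1}, (a * (dt ψ p + γ' p.2 * dr ψ p)
        + (b - a * γ' p.2) * dr ψ p) := by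
    congr 1; ext p; ring
  rw [hsplit, integral_add (hi1.integrableOn.const_mul a) hi2.integrableOn, integral_const_mul,
    integral_right_material_derivative hψ hc hγ hγ'm hC hF hd, mul_zero, zero_add,
    setIntegral_right_eq hγ hi2]
  refine integral_congr_ae (ae_of_all _ fun t => ?_)
  dsimp only
  rw [integral_const_mul]
  have hslice : ContDiff ℝ 1 (fun r => ψ (r, t)) := hψ.comp (by fun_prop)
  have hcs : HasCompactSupport (fun r => ψ (r, t)) := by
    refine HasCompactSupport.intro (hc.isCompact.image continuous_fst) fun r hr => ?_
    by_contra hne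
    exact hr ⟨(r, t), subset_tsupport ψ hne, rfl⟩
  have hder : ∀ r, dr ψ (r, t) = deriv (fun r => ψ (r, t)) r := fun r => by
    have h1 : HasDerivAt (fun r => (r, t)) ((1 : ℝ), (0 : ℝ)) r :=
      (hasDerivAt_id r).prodMk (hasDerivAt_const r t)
    exact (((hψ.differentiable one_ne_zero) (r, t)).hasFDerivAt.comp_hasDerivAt r h1).deriv.symm
  simp_rw [hder]
  rw [hcs.integral_Ioi_deriv_eq hslice]
  ring

end Regular

/-! ### From the radial system to the plane one -/

/-- The test function `r ^ (1 - n) * φ`, which turns the radial system into the plane one. -/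
def weighted (n : ℕ) (φ : ℝ × ℝ → ℝ) (p : ℝ × ℝ) : ℝ := p.1 ^ (1 - (n : ℤ)) * φ p

theorem isOpen_quadrant : IsOpen quadrant := isOpen_Ioi.prod isOpen_Ioi

section Test

variable {n : ℕ} {φ : ℝ × ℝ → ℝ}

theorem IsTestOn.mono {E : Type*} [NormedAddCommGroup E] [NormedSpace ℝ E] {Ω Ω' : Set E}
    {f : E → ℝ} (h : IsTestOn Ω f) (hΩ : Ω ⊆ Ω') : IsTestOn Ω' f :=
  ⟨h.1, h.2.1, h.2.2.trans hΩ⟩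

theorem IsTestOn.eq_zero {E : Type*} [NormedAddCommGroup E] [NormedSpace ℝ E] {Ω : Set E}
    {f : E → ℝ} (h : IsTestOn Ω f) {p : E} (hp : p ∉ Ω) : f p = 0 :=
  image_eq_zero_of_notMem_tsupport fun hh => hp (h.2.2 hh)

theorem contDiffAt_weight {k : ℤ} {p : ℝ × ℝ} (hp : 0 < p.1) {m : WithTop ℕ∞} :
    ContDiffAt ℝ m (fun q : ℝ × ℝ => q.1 ^ k) p := by
  obtain ⟨l, rfl | rfl⟩ := k.eq_nat_or_neg
  · simp only [zpow_natCast]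
    exact contDiffAt_fst.pow l
  · simp only [zpow_neg, zpow_natCast]
    exact (contDiffAt_fst.pow l).inv (by positivity)

/-- The weight is singular only at `r = 0`, and the support of `φ` is a closed set inside the
quadrant, so the product vanishes near every point outside the quadrant. -/
theorem contDiff_weighted (h : IsTestOn quadrant φ) : ContDiff ℝ 1 (weighted n φ) := by
  rw [contDiff_iff_contDiffAt]
  intro p
  by_cases hp : p ∈ quadrant
  · exact (contDiffAt_weight hp.1).mul (h.1.contDiffAt.of_le (by exact_mod_cast le_top))
  · have hz : φ =ᶠ[𝓝 p] 0 := notMem_tsupport_iff_eventuallyEq.1 fun hh => hp (h.2.2 hh)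
    refine (contDiffAt_const (c := (0 : ℝ))).congr_of_eventuallyEq ?_
    filter_upwards [hz] with q hq
    simp [weighted, hq]

theorem hasCompactSupport_weighted (h : IsTestOn quadrant φ) :
    HasCompactSupport (weighted n φ) := h.2.1.mul_left

theorem weighted_eq_zero (h : IsTestOn quadrant φ) {p : ℝ × ℝ} (hp : p ∉ quadrant) :
    weighted n φ p = 0 := by simp [weighted, h.eq_zero hp]

theorem fderiv_eq_zero_of_notMem (h : IsTestOn quadrant φ) {p : ℝ × ℝ} (hp : p ∉ quadrant) :
    fderiv ℝ (weighted n φ) p = 0 := by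
  have hz : φ =ᶠ[𝓝 p] 0 := notMem_tsupport_iff_eventuallyEq.1 fun hh => hp (h.2.2 hh)
  have hz' : weighted n φ =ᶠ[𝓝 p] fun _ => 0 := by
    filter_upwards [hz] with q hq
    simp [weighted, hq]
  rw [hz'.fderiv_eq, fderiv_fun_const]
  rfl

theorem dt_weighted_eq_zero (h : IsTestOn quadrant φ) {p : ℝ × ℝ} (hp : p ∉ quadrant) :
    dt (weighted n φ) p = 0 := by simp [dt, fderiv_eq_zero_of_notMem h hp]

theorem dr_weighted_eq_zero (h : IsTestOn quadrant φ) {p : ℝ × ℝ} (hp : p ∉ quadrant) :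
    dr (weighted n φ) p = 0 := by simp [dr, fderiv_eq_zero_of_notMem h hp]

theorem hasFDerivAt_weight {k : ℤ} {p : ℝ × ℝ} (hp : 0 < p.1) :
    HasFDerivAt (fun q : ℝ × ℝ => q.1 ^ k)
      (((k : ℝ) * p.1 ^ (k - 1)) • ContinuousLinearMap.fst ℝ ℝ ℝ) p :=
  (hasDerivAt_zpow k p.1 (Or.inl hp.ne')).comp_hasFDerivAt p hasFDerivAt_fst

theorem dt_weight_mul {k : ℤ} {g : ℝ × ℝ → ℝ} {p : ℝ × ℝ} (hp : 0 < p.1)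
    (hg : DifferentiableAt ℝ g p) :
    dt (fun q => q.1 ^ k * g q) p = p.1 ^ k * dt g p := by
  rw [dt, ((hasFDerivAt_weight hp).fun_mul hg.hasFDerivAt).fderiv]
  simp [dt]

theorem dr_weight_mul {k : ℤ} {g : ℝ × ℝ → ℝ} {p : ℝ × ℝ} (hp : 0 < p.1)
    (hg : DifferentiableAt ℝ g p) :
    dr (fun q => q.1 ^ k * g q) p = p.1 ^ k * dr g p + k * p.1 ^ (k - 1) * g p := by
  rw [dr, ((hasFDerivAt_weight hp).fun_mul hg.hasFDerivAt).fderiv]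
  simp [dr]
  ring

/-- Differentiating `r ^ (1 - n)` in `r` yields `(1 - n) / r`, which accounts for the source term.
What remains is the plane weak form with plane quantities `Q` and `G`. -/
theorem weakIntegrand_eq_weighted (h : IsTestOn quadrant φ) {q f : ℝ × ℝ → ℝ} {Q G : ℝ}
    {p : ℝ × ℝ} (hp : 0 < p.1) (hq : q p = p.1 ^ (1 - (n : ℤ)) * Q)
    (hf : f p = p.1 ^ (1 - (n : ℤ)) * G) :
    weakIntegrand n q f φ p = -(Q * dt (weighted n φ) p + G * dr (weighted n φ) p) := by
  have hd : DifferentiableAt ℝ φ p := h.1.differentiable (by simp) p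
  have h1 : dt (weighted n φ) p = _ := dt_weight_mul (k := 1 - (n : ℤ)) hp hd
  have h2 : dr (weighted n φ) p = _ := dr_weight_mul (k := 1 - (n : ℤ)) hp hd
  rw [h1, h2, weakIntegrand, hq, hf, zpow_sub_one₀ hp.ne']
  push_cast
  field_simp
  ring

theorem setIntegral_quadrant_eq {g : ℝ × ℝ → ℝ} (hg : ∀ p ∉ quadrant, g p = 0) :
    ∫ p in quadrant, g p = ∫ p, g p :=
  setIntegral_eq_integral_of_forall_compl_eq_zero hg

theorem integrable_mul_along_curve {ψ : ℝ × ℝ → ℝ} (hψ : Continuous ψ) (hc : HasCompactSupport ψ)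
    {γ : ℝ → ℝ} (hγ : Continuous γ) {k : ℝ → ℝ} (hk : Measurable k) {C : ℝ}
    (hC : ∀ t, |k t| ≤ C) : Integrable (fun t => k t * ψ (γ t, t)) := by
  have h0 := hasCompactSupport_along_curve hc (γ := γ) 0
  simp only [zero_add] at h0
  exact ((hψ.comp (by fun_prop : Continuous fun t => (γ t, t))).integrable_of_hasCompactSupport
    h0).bdd_mul (c := C) hk.aestronglyMeasurable (ae_of_all _ hC)

end Test

/-! ### Plane fronts -/

open Classical in
/-- The plane density on the inner side of the shadow wave. -/
def innerMass (ρl ul : ℝ) (X Y : ℝ → ℝ) (t : ℝ) : ℝ :=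
  if Y t = X t ∧ ul * t < X t then ρl else 0

/-- The rate at which the `j`-th moment of velocity flows into the shadow wave. -/
def momentFlux (ρl ρr ul ur : ℝ) (X v Y : ℝ → ℝ) (j : ℕ) (t : ℝ) : ℝ :=
  ρr * ur ^ j * (v t - ur) - innerMass ρl ul X Y t * ul ^ j * (v t - ul)

/-- The plane pressureless gas dynamics of a Riemann problem: a particle of mass `m(t)` at `X(t)`
with velocity `v(t)` separates the right state from the region inside, where the left state
occupies the interval from `ul * t` to `Y(t)`. -/
structure Front (R ρl ρr ul ur : ℝ) where
  X : ℝ → ℝ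
  v : ℝ → ℝ
  m : ℝ → ℝ
  Y : ℝ → ℝ
  F : Finset ℝ
  X_zero : X 0 = R
  X_deriv : ∀ t, HasDerivAt X (v t) t
  v_cont : Continuous v
  v_anti : Antitone v
  v_ge : ∀ t, ur ≤ v t
  v_le : ∃ C, ∀ t, v t ≤ C
  Y_or : (Y = X ∧ ∀ t, v t ≤ ul) ∨ (Y = (fun t => R + ul * t) ∧ ∀ t, ul < v t)
  cross : ∀ t ∉ F, Y t ≠ ul * t
  m_zero : m 0 = 0
  m_nonneg : ∀ t, 0 ≤ t → 0 ≤ m t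
  m_cont : Continuous m
  m_smooth : ∀ t, 0 < t → t ∉ F → ContDiffAt ℝ 1 m t
  v_smooth : ∀ t, 0 < t → t ∉ F → ContDiffAt ℝ 1 v t
  mass : ∀ t, 0 < t → t ∉ F → deriv m t = momentFlux ρl ρr ul ur X v Y 0 t
  momentum : ∀ t, 0 < t → t ∉ F →
    deriv (fun s => m s * v s) t = momentFlux ρl ρr ul ur X v Y 1 t

namespace Front

variable {R ρl ρr ul ur : ℝ} (f : Front R ρl ρr ul ur)

theorem X_cont : Continuous f.X :=
  continuous_iff_continuousAt.2 fun t => (f.X_deriv t).continuousAt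

theorem Y_cont : Continuous f.Y := by
  rcases f.Y_or with ⟨h, -⟩ | ⟨h, -⟩ <;> rw [h]
  · exact f.X_cont
  · fun_prop

theorem v_bdd : ∃ C, ∀ t, |f.v t| ≤ C := by
  obtain ⟨C, hC⟩ := f.v_le
  exact ⟨max |ur| |C|, fun t => abs_le_max_abs_abs (f.v_ge t) (hC t)⟩

theorem line_le_X {w : ℝ} (hw : ∀ t, w ≤ f.v t) {t : ℝ} (ht : 0 ≤ t) : R + w * t ≤ f.X t := by
  have hd : ∀ s, HasDerivAt (fun s => f.X s - w * s) (f.v s - w) s := fun s => by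
    simpa using (f.X_deriv s).fun_sub ((hasDerivAt_id s).const_mul w)
  have hm : Monotone (fun s => f.X s - w * s) :=
    monotone_of_deriv_nonneg (fun s => (hd s).differentiableAt) fun s => by
      rw [(hd s).deriv]; linarith [hw s]
  have := hm ht
  simp only [f.X_zero, mul_zero, sub_zero] at this
  linarith

theorem X_le_line {w : ℝ} (hw : ∀ t, f.v t ≤ w) {t : ℝ} (ht : 0 ≤ t) : f.X t ≤ R + w * t := by
  have hd : ∀ s, HasDerivAt (fun s => w * s - f.X s) (w - f.v s) s := fun s => by
    simpa using ((hasDerivAt_id s).const_mul w).fun_sub (f.X_deriv s)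
  have hm : Monotone (fun s => w * s - f.X s) :=
    monotone_of_deriv_nonneg (fun s => (hd s).differentiableAt) fun s => by
      rw [(hd s).deriv]; linarith [hw s]
  have := hm ht
  simp only [f.X_zero, mul_zero, zero_sub] at this
  linarith

theorem line_lt_X {w : ℝ} (hw : ∀ t, w < f.v t) {t : ℝ} (ht : 0 < t) : R + w * t < f.X t := by
  have hd : ∀ s, HasDerivAt (fun s => f.X s - w * s) (f.v s - w) s := fun s => by
    simpa using (f.X_deriv s).fun_sub ((hasDerivAt_id s).const_mul w)
  have hm : StrictMono (fun s => f.X s - w * s) :=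
    strictMono_of_deriv_pos fun s => by
      rw [(hd s).deriv]; linarith [hw s]
  have := hm ht
  simp only [f.X_zero, mul_zero, sub_zero] at this
  linarith

theorem Y_le_X {t : ℝ} (ht : 0 ≤ t) : f.Y t ≤ f.X t := by
  rcases f.Y_or with ⟨h, -⟩ | ⟨h, hv⟩ <;> rw [h]
  exact f.line_le_X (fun s => (hv s).le) ht

theorem measurable_innerMass : Measurable (innerMass ρl ul f.X f.Y) := by
  classical
  refine Measurable.ite ?_ measurable_const measurable_const
  exact (isClosed_eq f.Y_cont f.X_cont).measurableSet.inter
    (isOpen_lt (by fun_prop) f.X_cont).measurableSet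

theorem abs_innerMass_le (t : ℝ) : |innerMass ρl ul f.X f.Y t| ≤ |ρl| := by
  unfold innerMass
  split_ifs <;> simp

/-- The flux of the `j`-th moment into the front. -/
abbrev flux (j : ℕ) : ℝ → ℝ := momentFlux ρl ρr ul ur f.X f.v f.Y j

theorem measurable_flux (j : ℕ) : Measurable (f.flux j) :=
  ((f.v_cont.measurable.sub_const ur).const_mul _).sub
    ((f.measurable_innerMass.mul_const _).mul (f.v_cont.measurable.sub_const ul))

theorem flux_bdd (j : ℕ) : ∃ C, ∀ t, |f.flux j t| ≤ C := by
  obtain ⟨C, hC⟩ := f.v_bdd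
  refine ⟨|ρr * ur ^ j| * (C + |ur|) + |ρl| * |ul ^ j| * (C + |ul|), fun t => ?_⟩
  refine (abs_sub _ _).trans ?_
  rw [abs_mul, abs_mul, abs_mul (innerMass ρl ul f.X f.Y t * ul ^ j),
    abs_mul (innerMass ρl ul f.X f.Y t)]
  have h1 : ∀ w, |f.v t - w| ≤ C + |w| := fun w =>
    (abs_sub _ _).trans (by linarith [hC t])
  have h2 := f.abs_innerMass_le t
  exact add_le_add (mul_le_mul_of_nonneg_left (h1 ur) (by positivity))
    (mul_le_mul (mul_le_mul_of_nonneg_right h2 (by positivity)) (h1 ul) (by positivity)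
      (by positivity))

/-! ### The regular part in weak form -/

open Classical in
/-- The plane density of the regular part. -/
def dens (p : ℝ × ℝ) : ℝ :=
  if f.X p.2 < p.1 then ρr else if ul * p.2 < p.1 ∧ p.1 ≤ f.Y p.2 then ρl else 0

open Classical in
/-- The velocity of the regular part. -/
def vel (p : ℝ × ℝ) : ℝ :=
  if f.X p.2 < p.1 then ur else ul

/-- The inner boundary of the left state. -/
def Z (t : ℝ) : ℝ := min (f.Y t) (ul * t)

theorem Z_cont : Continuous f.Z := f.Y_cont.min (by fun_prop)

/-- The weak integrand of the regular part, written with half-planes. -/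
def halfPlaneIntegrand (j : ℕ) (ψ : ℝ × ℝ → ℝ) (p : ℝ × ℝ) : ℝ :=
  -({p : ℝ × ℝ | f.X p.2 < p.1}.indicator
      (fun p => ρr * ur ^ j * dt ψ p + ρr * ur ^ (j + 1) * dr ψ p) p
    + {p : ℝ × ℝ | f.Z p.2 < p.1}.indicator
      (fun p => ρl * ul ^ j * dt ψ p + ρl * ul ^ (j + 1) * dr ψ p) p
    - {p : ℝ × ℝ | f.Y p.2 < p.1}.indicator
      (fun p => ρl * ul ^ j * dt ψ p + ρl * ul ^ (j + 1) * dr ψ p) p)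

/-- From time zero on, `Z ≤ Y ≤ X`. The left state fills `Z < r ≤ Y`, a difference of two
half-planes that is empty once `ul * t` has overtaken `Y`, and the two indicators cancel in the
outer region. -/
theorem halfPlaneIntegrand_eq (j : ℕ) (ψ : ℝ × ℝ → ℝ) {p : ℝ × ℝ} (hp : 0 ≤ p.2) :
    f.halfPlaneIntegrand j ψ p
      = -(f.dens p * f.vel p ^ j * dt ψ p + f.dens p * f.vel p ^ (j + 1) * dr ψ p) := by
  have hYX := f.Y_le_X hp
  simp only [halfPlaneIntegrand, dens, vel, indicator, Set.mem_ofPred_eq, Z, min_lt_iff]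
  by_cases h1 : f.X p.2 < p.1
  · simp [h1, hYX.trans_lt h1]
  · by_cases h2 : f.Y p.2 < p.1
    · simp [h1, h2, h2.not_ge]
    · by_cases h3 : ul * p.2 < p.1
      · simp [h1, h2, h3, not_lt.1 h2]
      · simp [h1, h2, h3]

section Weak

variable {ψ : ℝ × ℝ → ℝ}

theorem integrable_halfPlaneIntegrand (j : ℕ) (hψ : ContDiff ℝ 1 ψ) (hc : HasCompactSupport ψ) :
    Integrable (f.halfPlaneIntegrand j ψ) := by
  have hi : ∀ a b : ℝ, Integrable (fun p => a * dt ψ p + b * dr ψ p) := fun a b =>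
    ((integrable_dt hψ hc).const_mul a).add ((integrable_dr hψ hc).const_mul b)
  exact ((((hi _ _).indicator (isOpen_right f.X_cont).measurableSet).add
    ((hi _ _).indicator (isOpen_right f.Z_cont).measurableSet)).sub
    ((hi _ _).indicator (isOpen_right f.Y_cont).measurableSet)).neg

/-- A boundary that moves with the velocity of the state it bounds carries no flux. So the line `ul
* t` and a detached `Y` contribute nothing, and only the two sides of `X` survive. -/
theorem integral_halfPlaneIntegrand (j : ℕ) (hψ : ContDiff ℝ 1 ψ) (hc : HasCompactSupport ψ)
    (hz : ∀ r t, t ≤ 0 → ψ (r, t) = 0) :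
    ∫ p, f.halfPlaneIntegrand j ψ p = -∫ t, f.flux j t * ψ (f.X t, t) := by
  classical
  have hi : ∀ a b : ℝ, Integrable (fun p => a * dt ψ p + b * dr ψ p) := fun a b =>
    ((integrable_dt hψ hc).const_mul a).add ((integrable_dr hψ hc).const_mul b)
  obtain ⟨C, hC⟩ := f.v_bdd
  -- Either `Y` is the particle path, or it travels with velocity `ul` and is strictly behind the
  -- particle at positive times.
  obtain ⟨Y', hY'm, hY'd, hY'b, hY'c⟩ : ∃ Y' : ℝ → ℝ, Measurable Y' ∧
      (∀ t, HasDerivAt f.Y (Y' t) t) ∧ (∀ t, |Y' t| ≤ C + |ul|) ∧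
      ((f.Y = f.X ∧ Y' = f.v) ∨ ((∀ t, Y' t = ul) ∧ ∀ t, 0 < t → f.Y t < f.X t)) := by
    rcases f.Y_or with ⟨h, -⟩ | ⟨h, hv⟩
    · refine ⟨f.v, f.v_cont.measurable, fun t => ?_, fun t => ?_, Or.inl ⟨h, rfl⟩⟩
      · rw [h]; exact f.X_deriv t
      · linarith [hC t, abs_nonneg ul]
    · refine ⟨fun _ => ul, measurable_const, fun t => ?_, fun t => ?_,
        Or.inr ⟨fun _ => rfl, fun t ht => ?_⟩⟩
      · rw [h]; simpa using ((hasDerivAt_id t).const_mul ul).const_add R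
      · linarith [(abs_nonneg _).trans (hC 0)]
      · rw [h]; exact f.line_lt_X hv ht
  set Z' : ℝ → ℝ := fun t => if f.Y t < ul * t then Y' t else ul with hZ'
  have hZ'm : Measurable Z' := Measurable.ite
    (isOpen_lt f.Y_cont (by fun_prop)).measurableSet hY'm measurable_const
  have hZ'b : ∀ t, |Z' t| ≤ C + |ul| := fun t => by
    simp only [hZ']
    split_ifs
    · exact hY'b t
    · linarith [(abs_nonneg _).trans (hC 0)]
  have hZ'd : ∀ t ∉ (f.F : Set ℝ), HasDerivAt f.Z (Z' t) t := fun t ht => by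
    rcases lt_or_gt_of_ne (f.cross t (by simpa using ht)) with h | h
    · simp only [hZ', if_pos h]
      refine (hY'd t).congr_of_eventuallyEq ?_
      filter_upwards [f.Y_cont.continuousAt.eventually_lt (by fun_prop) h] with s hs
      exact min_eq_left hs.le
    · simp only [hZ', if_neg h.not_gt]
      have h0 : HasDerivAt (fun s => ul * s) ul t := by
        simpa using (hasDerivAt_id t).const_mul ul
      refine h0.congr_of_eventuallyEq ?_
      have : ∀ᶠ s in 𝓝 t, ul * s < f.Y s :=
        ContinuousAt.eventually_lt (by fun_prop) f.Y_cont.continuousAt h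
      filter_upwards [this] with s hs
      exact min_eq_right hs.le
  have hFc := f.F.countable_toSet
  have key : ∀ (a b : ℝ) {γ γ' : ℝ → ℝ} {D : ℝ}, Continuous γ → Measurable γ' →
      (∀ t, |γ' t| ≤ D) → Integrable fun t => (a * γ' t - b) * ψ (γ t, t) := by
    intro a b γ γ' D hγ hγ' hD
    refine integrable_mul_along_curve hψ.continuous hc hγ (k := fun t => a * γ' t - b)
      (by fun_prop) (C := |a| * D + |b|) fun t => (abs_sub _ _).trans ?_
    rw [abs_mul]
    gcongr
    exact hD t
  have iX := key (ρr * ur ^ j) (ρr * ur ^ (j + 1)) f.X_cont f.v_cont.measurable hC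
  have iZ := key (ρl * ul ^ j) (ρl * ul ^ (j + 1)) f.Z_cont hZ'm hZ'b
  have iY := key (ρl * ul ^ j) (ρl * ul ^ (j + 1)) f.Y_cont hY'm hY'b
  have jX := (hi (ρr * ur ^ j) (ρr * ur ^ (j + 1))).indicator
    (isOpen_right f.X_cont).measurableSet
  have jZ := (hi (ρl * ul ^ j) (ρl * ul ^ (j + 1))).indicator
    (isOpen_right f.Z_cont).measurableSet
  have jY := (hi (ρl * ul ^ j) (ρl * ul ^ (j + 1))).indicator
    (isOpen_right f.Y_cont).measurableSet
  simp only [halfPlaneIntegrand]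
  rw [integral_neg, integral_sub (by exact jX.add jZ) jY, integral_add jX jZ,
    integral_indicator (isOpen_right f.X_cont).measurableSet,
    integral_indicator (isOpen_right f.Z_cont).measurableSet,
    integral_indicator (isOpen_right f.Y_cont).measurableSet,
    integral_right_of_curve hψ hc f.X_cont f.v_cont.measurable hC hFc
      (fun t _ => f.X_deriv t),
    integral_right_of_curve hψ hc f.Z_cont hZ'm hZ'b hFc hZ'd,
    integral_right_of_curve hψ hc f.Y_cont hY'm hY'b hFc (fun t _ => hY'd t),
    ← integral_add iX iZ, ← integral_sub (by exact iX.add iZ) iY]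
  congr 1
  refine integral_congr_ae ?_
  filter_upwards [hFc.ae_notMem volume] with t ht
  have ht' := f.cross t (by simpa using ht)
  simp only [flux, momentFlux, innerMass, hZ', Z]
  rcases le_or_gt t 0 with ht0 | ht0
  · simp [hz _ t ht0]
  rcases hY'c with ⟨h, h'⟩ | ⟨h, h'⟩
  -- If `Y = X`, the terms of `Z` and `Y` cancel once the inner matter is exhausted; before that,
  -- the term of `Y` is the inner flux.
  · rw [h] at ht'
    rw [h, h']
    rcases lt_or_gt_of_ne ht' with h1 | h1
    · rw [if_pos h1, min_eq_left h1.le, if_neg (by simp [h1.le])]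
      ring
    · rw [if_neg h1.not_gt, if_pos ⟨rfl, h1⟩]
      ring
  · rw [h, ite_self, if_neg (fun hh => (h' t ht0).ne hh.1)]
    ring

end Weak

end Front

/-! ### Weak limits of the approximating family -/

theorem WeakLimit.const_mul {n : ℕ} {q g : ℝ → ℝ × ℝ → ℝ} {φ : ℝ × ℝ → ℝ} {L : ℝ}
    (h : WeakLimit n q g φ L) (k : ℝ) :
    WeakLimit n (fun ε p => k * q ε p) (fun ε p => k * g ε p) φ (k * L) := by
  have e : ∀ ε p, weakIntegrand n (fun p => k * q ε p) (fun p => k * g ε p) φ p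
      = k * weakIntegrand n (q ε) (g ε) φ p := fun ε p => by
    simp only [weakIntegrand]; ring
  refine ⟨?_, ?_⟩
  · filter_upwards [h.1] with ε hε
    rw [funext (e ε)]
    exact hε.const_mul k
  · simp_rw [e, integral_const_mul]
    exact h.2.const_mul k

/-- Keeps all computations with negative powers of `r` and of the wave position away from the
origin. -/
theorem IsTestOn.exists_radius {φ : ℝ × ℝ → ℝ} (h : IsTestOn quadrant φ) :
    ∃ δ > 0, ∀ p ∈ tsupport φ, δ ≤ p.1 := by
  rcases (tsupport φ).eq_empty_or_nonempty with h0 | h0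
  · exact ⟨1, one_pos, by simp [h0]⟩
  · obtain ⟨p, hp, hmin⟩ := h.2.1.isCompact.exists_isMinOn h0 continuous_fst.continuousOn
    exact ⟨p.1, (h.2.2 hp).1, fun q hq => hmin hq⟩

theorem weighted_eventually_zero {n : ℕ} {φ : ℝ × ℝ → ℝ} {p : ℝ × ℝ} (hp : p ∉ tsupport φ) :
    weighted n φ =ᶠ[𝓝 p] fun _ => 0 := by
  filter_upwards [notMem_tsupport_iff_eventuallyEq.1 hp] with q hq
  simp [weighted, hq]

theorem weighted_derivs_eq_zero {n : ℕ} {φ : ℝ × ℝ → ℝ} {p : ℝ × ℝ} (hp : p ∉ tsupport φ) :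
    dt (weighted n φ) p = 0 ∧ dr (weighted n φ) p = 0 := by
  have : fderiv ℝ (weighted n φ) p = 0 := by
    rw [(weighted_eventually_zero hp).fderiv_eq, fderiv_fun_const]
    rfl
  simp [dt, dr, this]

namespace Front

variable {R ρl ρr ul ur : ℝ} (f : Front R ρl ρr ul ur)

open Classical in
/-- The mass at the origin. -/
def originMass (n : ℕ) (T : EReal) (t : ℝ) : ℝ :=
  if (t : EReal) < T then sphereArea n * (ρl * max 0 (min R (-ul * t)))
  else sphereArea n * (ρl * max 0 (min R (-ul * T.toReal)) + f.m T.toReal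
    + ρr * -ur * (t - T.toReal))

/-- The radial shadow wave that lives until time `T`. -/
def wave (n : ℕ) (T : EReal) : ShadowWave where
  ρ p := p.1 ^ (1 - (n : ℤ)) * f.dens p
  u := f.vel
  c t := f.X t - R
  σ t := f.m t * f.X t ^ (1 - (n : ℤ))
  v := f.v
  T := T
  m₀ := f.originMass n T

variable {n : ℕ} {T : EReal} {φ : ℝ × ℝ → ℝ}

theorem position_eq (t : ℝ) : R + (f.wave n T).c t = f.X t := by simp [wave]

theorem abs_dens_mul_le (j : ℕ) (p : ℝ × ℝ) :
    |f.dens p * f.vel p ^ j| ≤ |ρr * ur ^ j| + |ρl * ul ^ j| := by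
  unfold dens vel
  split_ifs
  · linarith [abs_nonneg (ρl * ul ^ j)]
  · linarith [abs_nonneg (ρr * ur ^ j)]
  · rw [zero_mul, abs_zero]; positivity

theorem weakIntegrand_regular (j : ℕ) (h : IsTestOn quadrant φ) {p : ℝ × ℝ} (hp : p ∈ quadrant) :
    weakIntegrand n (fun p => (f.wave n T).ρ p * (f.wave n T).u p ^ j)
      (fun p => (f.wave n T).ρ p * (f.wave n T).u p ^ (j + 1)) φ p
      = f.halfPlaneIntegrand j (weighted n φ) p := by
  rw [f.halfPlaneIntegrand_eq j _ (le_of_lt hp.2)]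
  exact weakIntegrand_eq_weighted h hp.1 (mul_assoc _ _ _) (mul_assoc _ _ _)

theorem halfPlaneIntegrand_eq_zero (j : ℕ) (h : IsTestOn quadrant φ) {p : ℝ × ℝ}
    (hp : p ∉ quadrant) : f.halfPlaneIntegrand j (weighted n φ) p = 0 := by
  simp [halfPlaneIntegrand, indicator, dt_weighted_eq_zero h hp, dr_weighted_eq_zero h hp]

theorem weighted_zero_time (h : IsTestOn quadrant φ) {r t : ℝ} (ht : t ≤ 0) :
    weighted n φ (r, t) = 0 := weighted_eq_zero h fun hp => not_lt.2 ht hp.2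

theorem regular_integrableOn (j : ℕ) (h : IsTestOn quadrant φ) :
    IntegrableOn (weakIntegrand n (fun p => (f.wave n T).ρ p * (f.wave n T).u p ^ j)
      (fun p => (f.wave n T).ρ p * (f.wave n T).u p ^ (j + 1)) φ) quadrant :=
  (f.integrable_halfPlaneIntegrand j (contDiff_weighted h)
    (hasCompactSupport_weighted h)).integrableOn.congr_fun
    (fun _ hp => (f.weakIntegrand_regular j h hp).symm) isOpen_quadrant.measurableSet

theorem regular_integral (j : ℕ) (h : IsTestOn quadrant φ) :
    ∫ p in quadrant, weakIntegrand n (fun p => (f.wave n T).ρ p * (f.wave n T).u p ^ j)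
      (fun p => (f.wave n T).ρ p * (f.wave n T).u p ^ (j + 1)) φ p
      = -∫ t, f.flux j t * weighted n φ (f.X t, t) := by
  rw [setIntegral_congr_fun isOpen_quadrant.measurableSet
      (fun p hp => f.weakIntegrand_regular j h hp),
    setIntegral_quadrant_eq (fun p hp => f.halfPlaneIntegrand_eq_zero j h hp),
    f.integral_halfPlaneIntegrand j (contDiff_weighted h) (hasCompactSupport_weighted h)
      (fun r t ht => weighted_zero_time h ht)]

/-- The defect of the regular part is concentrated on the particle path, where test functions
supported in `Ω` vanish. Both the inner and the outer region are of this kind. -/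
theorem weakEqOn_of_avoids (j : ℕ) {Ω : Set (ℝ × ℝ)} (hΩ : Ω ⊆ quadrant)
    (hX : ∀ t, (f.X t, t) ∉ Ω) :
    WeakEqOn n Ω (fun p => (f.wave n T).ρ p * (f.wave n T).u p ^ j)
      (fun p => (f.wave n T).ρ p * (f.wave n T).u p ^ (j + 1)) := by
  intro φ hφ
  have h := hφ.mono hΩ
  refine ⟨f.regular_integrableOn j h, ?_⟩
  rw [f.regular_integral j h]
  have : ∀ t, weighted n φ (f.X t, t) = 0 := fun t => by
    simp [weighted, hφ.eq_zero (hX t)]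
  simp [this]

theorem isWeakSolutionOn_of_avoids {Ω : Set (ℝ × ℝ)} (hΩ : Ω ⊆ quadrant)
    (hX : ∀ t, (f.X t, t) ∉ Ω) :
    IsWeakSolutionOn n Ω (f.wave n T).ρ (f.wave n T).u := by
  have h0 := f.weakEqOn_of_avoids (n := n) (T := T) 0 hΩ hX
  have h1 := f.weakEqOn_of_avoids (n := n) (T := T) 1 hΩ hX
  simp only [pow_zero, mul_one, zero_add, pow_one] at h0
  simp only [pow_one, one_add_one_eq_two] at h1
  exact ⟨h0, h1⟩

/-- The integrand is dominated by the continuous, compactly supported `k`, whose integral over the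
strip is `ε` times a convergent average. -/
theorem tendsto_strip_halfPlane (j : ℕ) {ψ : ℝ × ℝ → ℝ} (hψ : ContDiff ℝ 1 ψ)
    (hc : HasCompactSupport ψ) (hz : ∀ p ∉ quadrant, f.halfPlaneIntegrand j ψ p = 0) :
    Tendsto (fun ε : ℝ => ∫ p in {p : ℝ × ℝ | |p.1 - f.X p.2| < ε / 2},
      f.halfPlaneIntegrand j ψ p) (𝓝[>] 0) (𝓝 0) := by
  set C := |ρr * ur ^ j| + |ρl * ul ^ j|
  set D := |ρr * ur ^ (j + 1)| + |ρl * ul ^ (j + 1)|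
  set k : ℝ × ℝ → ℝ := fun p => C * |dt ψ p| + D * |dr ψ p| with hk
  have hkc : Continuous k := ((continuous_dt hψ).abs.const_mul C).add
    ((continuous_dr hψ).abs.const_mul D)
  have hks : HasCompactSupport k := by
    refine HasCompactSupport.add ?_ ?_
    · exact (hasCompactSupport_dt hc).comp_left (g := fun x => C * |x|) (by simp)
    · exact (hasCompactSupport_dr hc).comp_left (g := fun x => D * |x|) (by simp)
  have hle : ∀ p, ‖f.halfPlaneIntegrand j ψ p‖ ≤ k p := fun p => by
    by_cases hp : p ∈ quadrant
    · rw [f.halfPlaneIntegrand_eq j ψ (le_of_lt hp.2), norm_neg, Real.norm_eq_abs]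
      refine (abs_add_le _ _).trans ?_
      rw [abs_mul, abs_mul _ (dr ψ p)]
      exact add_le_add (mul_le_mul_of_nonneg_right (f.abs_dens_mul_le _ p) (abs_nonneg _))
        (mul_le_mul_of_nonneg_right (f.abs_dens_mul_le _ p) (abs_nonneg _))
    · rw [hz p hp, norm_zero]; positivity
  have hlim : Tendsto (fun ε : ℝ => ∫ p in {p : ℝ × ℝ | |p.1 - f.X p.2| < ε / 2}, k p)
      (𝓝[>] 0) (𝓝 0) := by
    have h1 := (tendsto_nhdsWithin_of_tendsto_nhds (s := Ioi 0) (tendsto_id (x := 𝓝 (0 : ℝ)))).mul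
      (tendsto_strip_integral hkc hks f.X_cont)
    rw [zero_mul] at h1
    refine h1.congr' ?_
    filter_upwards [self_mem_nhdsWithin] with ε hε
    have : ε ≠ 0 := ne_of_gt hε
    rw [id, ← mul_assoc, mul_one_div_cancel this, one_mul]
  refine squeeze_zero_norm (fun ε => ?_) hlim
  exact norm_integral_le_of_norm_le (hkc.integrable_of_hasCompactSupport hks).integrableOn
    (ae_of_all _ hle)

/-- A globally continuous function that equals `r ^ (n - 1) * σ * v ^ j` on thin strips around the
wave, as long as the wave is not close to the origin. -/
def stripDensity (n : ℕ) (δ : ℝ) (j : ℕ) (p : ℝ × ℝ) : ℝ :=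
  (max p.1 δ) ^ ((n : ℤ) - 1) * (max (f.X p.2) δ) ^ (1 - (n : ℤ)) * f.m p.2 * f.v p.2 ^ j

theorem continuous_stripDensity {δ : ℝ} (hδ : 0 < δ) (j : ℕ) :
    Continuous (f.stripDensity n δ j) := by
  have h1 : Continuous fun p : ℝ × ℝ => (max p.1 δ) ^ ((n : ℤ) - 1) :=
    (continuous_fst.max continuous_const).zpow₀ _ fun p =>
      Or.inl (lt_max_of_lt_right hδ).ne'
  have h2 : Continuous fun p : ℝ × ℝ => (max (f.X p.2) δ) ^ (1 - (n : ℤ)) :=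
    ((f.X_cont.comp continuous_snd).max continuous_const).zpow₀ _ fun p =>
      Or.inl (lt_max_of_lt_right hδ).ne'
  exact ((h1.mul h2).mul (f.m_cont.comp continuous_snd)).mul
    ((f.v_cont.comp continuous_snd).pow j)

/-- The limit of the weak integrand on the strip, multiplied by its width. -/
def stripIntegrand (n : ℕ) (δ : ℝ) (j : ℕ) (ψ : ℝ × ℝ → ℝ) (p : ℝ × ℝ) : ℝ :=
  -(f.stripDensity n δ j p * dt ψ p + f.stripDensity n δ (j + 1) p * dr ψ p)

/-- Splits the approximating family into its regular part and a correction on the strip, of order `1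
/ ε` with a coefficient independent of `ε`. On the strip the density is constant in `r`, which is
why `stripDensity` carries the factor `r ^ (n - 1)`. -/
theorem weakIntegrand_wave (hT : ∀ t : ℝ, 0 ≤ t → ((t : EReal) < T ↔ 0 < f.X t)) (j : ℕ)
    (h : IsTestOn quadrant φ) {δ ε : ℝ} (hδ : ∀ p ∈ tsupport φ, 2 * δ ≤ p.1) (hδ0 : 0 < δ)
    (hε2 : ε < δ) {p : ℝ × ℝ} (hp : p ∈ quadrant) :
    weakIntegrand n (fun p => (f.wave n T).ρSW R ε p * (f.wave n T).uSW R ε p ^ j)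
      (fun p => (f.wave n T).ρSW R ε p * (f.wave n T).uSW R ε p ^ (j + 1)) φ p
      = f.halfPlaneIntegrand j (weighted n φ) p
        + {p : ℝ × ℝ | |p.1 - f.X p.2| < ε / 2}.indicator
          (fun p => 1 / ε * f.stripIntegrand n δ j (weighted n φ) p
            - f.halfPlaneIntegrand j (weighted n φ) p) p := by
  have hr : 0 < p.1 := hp.1
  by_cases hs : p ∈ tsupport φ
  swap
  · have hd := weighted_derivs_eq_zero (n := n) hs
    rw [weakIntegrand_eq_weighted (n := n) h hr
      (Q := p.1 ^ ((n : ℤ) - 1) * ((f.wave n T).ρSW R ε p * (f.wave n T).uSW R ε p ^ j))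
      (G := p.1 ^ ((n : ℤ) - 1) * ((f.wave n T).ρSW R ε p * (f.wave n T).uSW R ε p ^ (j + 1)))]
    · simp [indicator, halfPlaneIntegrand, stripIntegrand, hd]
    · rw [← mul_assoc, ← zpow_add₀ hr.ne']; simp
    · rw [← mul_assoc, ← zpow_add₀ hr.ne']; simp
  have hδr := hδ p hs
  by_cases hst : |p.1 - f.X p.2| < ε / 2
  -- A strip meeting the support lies at radius at least `2 * δ` there, and its half-width is below
  -- `δ`. So the wave is still away from the origin, hence alive, and the cut-offs in `stripDensity`
  -- are inactive.
  · have hX : δ < f.X p.2 := by have := (abs_lt.1 hst).2; linarith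
    have hlife : p.2 ∈ (f.wave n T).life :=
      ⟨le_of_lt hp.2, (hT p.2 (le_of_lt hp.2)).2 (hδ0.trans hX)⟩
    have hcond : p.2 ∈ (f.wave n T).life ∧ |p.1 - (R + (f.wave n T).c p.2)| < ε / 2 :=
      ⟨hlife, by rwa [f.position_eq]⟩
    have hpow : ∀ i, f.stripDensity n δ i p
        = p.1 ^ ((n : ℤ) - 1) * (f.X p.2 ^ (1 - (n : ℤ)) * f.m p.2 * f.v p.2 ^ i) := fun i => by
      rw [stripDensity, max_eq_left (by linarith), max_eq_left hX.le]; ring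
    have hq : ∀ i, (f.wave n T).ρSW R ε p * (f.wave n T).uSW R ε p ^ i
        = p.1 ^ (1 - (n : ℤ)) * (1 / ε * f.stripDensity n δ i p) := fun i => by
      have hone : p.1 ^ (1 - (n : ℤ)) * p.1 ^ ((n : ℤ) - 1) = 1 := by
        rw [← zpow_add₀ hr.ne']; simp
      rw [ShadowWave.ρSW, ShadowWave.uSW, if_pos hcond, if_pos hcond, hpow]
      simp only [wave]
      linear_combination (-(f.m p.2 * f.X p.2 ^ (1 - (n : ℤ)) / ε * f.v p.2 ^ i)) * hone
    rw [weakIntegrand_eq_weighted (n := n) h hr (hq j) (hq (j + 1)),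
      indicator_of_mem (by exact hst), stripIntegrand]
    ring
  · have hcond : ¬(p.2 ∈ (f.wave n T).life ∧ |p.1 - (R + (f.wave n T).c p.2)| < ε / 2) := by
      rw [f.position_eq]; exact fun hh => hst hh.2
    rw [indicator_of_notMem (by exact hst), add_zero,
      ← f.weakIntegrand_regular (T := T) j h hp]
    simp only [weakIntegrand, ShadowWave.ρSW, ShadowWave.uSW, if_neg hcond]

theorem stripIntegrand_on_curve {δ : ℝ} (j : ℕ) (hδ : ∀ p ∈ tsupport φ, 2 * δ ≤ p.1)
    (hδ0 : 0 < δ) (t : ℝ) :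
    f.stripIntegrand n δ j (weighted n φ) (f.X t, t)
      = -(f.m t * f.v t ^ j * (dt (weighted n φ) (f.X t, t)
        + f.v t * dr (weighted n φ) (f.X t, t))) := by
  by_cases hs : (f.X t, t) ∈ tsupport φ
  · have hX : 2 * δ ≤ f.X t := hδ _ hs
    have hone : f.X t ^ ((n : ℤ) - 1) * f.X t ^ (1 - (n : ℤ)) = 1 := by
      rw [← zpow_add₀ (by linarith)]; simp
    simp only [stripIntegrand, stripDensity, max_eq_left (show δ ≤ f.X t by linarith), hone]
    ring
  · have hd := weighted_derivs_eq_zero (n := n) hs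
    simp [stripIntegrand, hd]

theorem continuous_stripIntegrand {δ : ℝ} (hδ : 0 < δ) (j : ℕ) (h : IsTestOn quadrant φ) :
    Continuous (f.stripIntegrand n δ j (weighted n φ)) :=
  (((f.continuous_stripDensity hδ j).mul (continuous_dt (contDiff_weighted h))).add
    ((f.continuous_stripDensity hδ (j + 1)).mul (continuous_dr (contDiff_weighted h)))).neg

theorem hasCompactSupport_stripIntegrand {δ : ℝ} (j : ℕ) (h : IsTestOn quadrant φ) :
    HasCompactSupport (f.stripIntegrand n δ j (weighted n φ)) :=
  HasCompactSupport.intro h.2.1.isCompact fun p hp => by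
    simp [stripIntegrand, weighted_derivs_eq_zero (n := n) hp]

/-- Integration by parts along the path: `m * v ^ j * ψ (X t, t)` has compact support, so its total
derivative integrates to zero. -/
theorem integral_wave_derivative (j : ℕ) (h : IsTestOn quadrant φ) {D : ℝ → ℝ} (hDm : Measurable D)
    {C : ℝ} (hDC : ∀ t, |D t| ≤ C)
    (hD : ∀ t, 0 < t → t ∉ f.F → HasDerivAt (fun s => f.m s * f.v s ^ j) (D t) t) :
    ∫ t, f.m t * f.v t ^ j * (dt (weighted n φ) (f.X t, t)
        + f.v t * dr (weighted n φ) (f.X t, t))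
      = -∫ t, D t * weighted n φ (f.X t, t) := by
  set ψ := weighted n φ with hψdef
  have hψ : ContDiff ℝ 1 ψ := contDiff_weighted h
  have hc : HasCompactSupport ψ := hasCompactSupport_weighted h
  have hcs : ∀ {g : ℝ × ℝ → ℝ}, HasCompactSupport g → HasCompactSupport fun t => g (f.X t, t) :=
    fun hg => by simpa using hasCompactSupport_along_curve hg (γ := f.X) 0
  have hcX : Continuous fun t => (f.X t, t) := f.X_cont.prodMk continuous_id
  have hmv : Continuous fun t => f.m t * f.v t ^ j := f.m_cont.mul (f.v_cont.pow j)
  have i1 : Integrable fun t => D t * ψ (f.X t, t) :=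
    integrable_mul_along_curve hψ.continuous hc f.X_cont hDm hDC
  have i2 : Integrable fun t => f.m t * f.v t ^ j * (dt ψ (f.X t, t) + f.v t * dr ψ (f.X t, t)) := by
    refine Continuous.integrable_of_hasCompactSupport (hmv.mul
      (((continuous_dt hψ).comp hcX).add (f.v_cont.mul ((continuous_dr hψ).comp hcX)))) ?_
    exact ((hcs (hasCompactSupport_dt hc)).add (hcs (hasCompactSupport_dr hc)).mul_left).mul_left
  rw [eq_neg_iff_add_eq_zero, add_comm, ← integral_add i1 i2]
  refine integral_eq_zero_of_hasDerivAt_off_countable f.F.countable_toSet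
    (g := fun t => f.m t * f.v t ^ j * ψ (f.X t, t)) (hmv.mul (hψ.continuous.comp hcX))
    (hcs hc).mul_left (fun t ht => ?_) (i1.add i2)
  rcases le_or_gt t 0 with ht0 | ht0
  -- The balance laws are available only for positive times; up to time zero the test function
  -- vanishes near the path.
  · have hs : (f.X t, t) ∉ tsupport φ := fun hh => not_lt.2 ht0 (h.2.2 hh).2
    have hz := (weighted_eventually_zero (n := n) hs)
    have hd := weighted_derivs_eq_zero (n := n) hs
    rw [hψdef, hd.1, hd.2, hz.self_of_nhds]
    simp only [mul_zero, add_zero]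
    refine (hasDerivAt_const t (0 : ℝ)).congr_of_eventuallyEq ?_
    filter_upwards [hcX.continuousAt.eventually hz] with s hs'
    simp [hs']
  · have h2 := hasDerivAt_along_curve hψ (f.X_deriv t) 0
    simp only [zero_add] at h2
    exact (hD t ht0 (by simpa using ht)).fun_mul h2

/-- The weak limit of the `j`-th moment equation is concentrated on the wave. -/
theorem weakLimit_moment (hT : ∀ t : ℝ, 0 ≤ t → ((t : EReal) < T ↔ 0 < f.X t)) (j : ℕ)
    (h : IsTestOn quadrant φ) {D : ℝ → ℝ} (hDm : Measurable D)
    {C : ℝ} (hDC : ∀ t, |D t| ≤ C)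
    (hD : ∀ t, 0 < t → t ∉ f.F → HasDerivAt (fun s => f.m s * f.v s ^ j) (D t) t) :
    WeakLimit n (fun ε p => (f.wave n T).ρSW R ε p * (f.wave n T).uSW R ε p ^ j)
      (fun ε p => (f.wave n T).ρSW R ε p * (f.wave n T).uSW R ε p ^ (j + 1)) φ
      (∫ t, (D t - f.flux j t) * weighted n φ (f.X t, t)) := by
  obtain ⟨δ', hδ'0, hδ'⟩ := h.exists_radius
  obtain ⟨δ, rfl⟩ : ∃ δ, δ' = 2 * δ := ⟨δ' / 2, by ring⟩
  have hδ0 : 0 < δ := by linarith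
  have hψ := contDiff_weighted (n := n) h
  have hc := hasCompactSupport_weighted (n := n) h
  have iH := f.integrable_halfPlaneIntegrand j hψ hc
  have cS := f.continuous_stripIntegrand (n := n) hδ0 j h
  have sS := f.hasCompactSupport_stripIntegrand (n := n) (δ := δ) j h
  have iS := cS.integrable_of_hasCompactSupport sS (μ := volume)
  have hms : ∀ ε : ℝ, MeasurableSet {p : ℝ × ℝ | |p.1 - f.X p.2| < ε / 2} := fun ε =>
    (isOpen_strip f.X_cont ε).measurableSet
  have iD : ∀ ε : ℝ, Integrable (fun p => 1 / ε * f.stripIntegrand n δ j (weighted n φ) p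
      - f.halfPlaneIntegrand j (weighted n φ) p) := fun ε => (iS.const_mul _).sub iH
  have hsmall : ∀ᶠ ε : ℝ in 𝓝[>] 0, ε < δ := nhdsWithin_le_nhds (Iio_mem_nhds hδ0)
  refine ⟨?_, ?_⟩
  · filter_upwards [hsmall] with ε hε
    exact (iH.add ((iD ε).indicator (hms ε))).integrableOn.congr_fun
      (fun p hp => (f.weakIntegrand_wave hT j h hδ' hδ0 hε hp).symm) isOpen_quadrant.measurableSet
  · have hint : ∀ᶠ ε : ℝ in 𝓝[>] 0,
        -(∫ t, f.flux j t * weighted n φ (f.X t, t))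
          + (1 / ε * (∫ p in {p : ℝ × ℝ | |p.1 - f.X p.2| < ε / 2},
            f.stripIntegrand n δ j (weighted n φ) p)
          - ∫ p in {p : ℝ × ℝ | |p.1 - f.X p.2| < ε / 2},
            f.halfPlaneIntegrand j (weighted n φ) p)
        = ∫ p in quadrant, weakIntegrand n
          (fun p => (f.wave n T).ρSW R ε p * (f.wave n T).uSW R ε p ^ j)
          (fun p => (f.wave n T).ρSW R ε p * (f.wave n T).uSW R ε p ^ (j + 1)) φ p := by
      filter_upwards [hsmall] with ε hε
      rw [setIntegral_congr_fun isOpen_quadrant.measurableSet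
        (fun p hp => f.weakIntegrand_wave hT j h hδ' hδ0 hε hp), setIntegral_quadrant_eq,
        integral_add iH ((iD ε).indicator (hms ε)), integral_indicator (hms ε),
        integral_sub (iS.const_mul _).integrableOn iH.integrableOn, integral_const_mul,
        f.integral_halfPlaneIntegrand j hψ hc (fun r t ht => weighted_zero_time h ht)]
      intro p hp
      simp [halfPlaneIntegrand, stripIntegrand, indicator, dt_weighted_eq_zero h hp,
        dr_weighted_eq_zero h hp]
    -- Three contributions remain: the flux of the regular part, the strip average, which converges
    -- to a line integral along the path, and the regular part removed from the strip, which tends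
    -- to zero.
    refine Tendsto.congr' hint ?_
    have hlim := ((tendsto_strip_integral cS sS f.X_cont).sub
      (f.tendsto_strip_halfPlane j hψ hc fun p hp => f.halfPlaneIntegrand_eq_zero j h hp)).const_add
        (-(∫ t, f.flux j t * weighted n φ (f.X t, t)))
    convert hlim using 2
    simp_rw [f.stripIntegrand_on_curve j hδ' hδ0]
    rw [integral_neg, f.integral_wave_derivative j h hDm hDC hD]
    obtain ⟨B, hB⟩ := f.flux_bdd j
    simp_rw [sub_mul]
    rw [integral_sub (integrable_mul_along_curve hψ.continuous hc f.X_cont hDm hDC)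
      (integrable_mul_along_curve hψ.continuous hc f.X_cont (f.measurable_flux j) hB)]
    ring

/-! ### Conservation of mass and momentum, dissipation of energy -/

theorem hasDerivAt_m {t : ℝ} (ht : 0 < t) (hF : t ∉ f.F) : HasDerivAt f.m (f.flux 0 t) t := by
  have := ((f.m_smooth t ht hF).differentiableAt one_ne_zero).hasDerivAt
  rwa [f.mass t ht hF] at this

theorem hasDerivAt_v {t : ℝ} (ht : 0 < t) (hF : t ∉ f.F) : HasDerivAt f.v (deriv f.v t) t :=
  ((f.v_smooth t ht hF).differentiableAt one_ne_zero).hasDerivAt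

theorem hasDerivAt_mv {t : ℝ} (ht : 0 < t) (hF : t ∉ f.F) :
    HasDerivAt (fun s => f.m s * f.v s) (f.flux 1 t) t := by
  have := ((f.hasDerivAt_m ht hF).fun_mul (f.hasDerivAt_v ht hF)).differentiableAt.hasDerivAt
  rwa [f.momentum t ht hF] at this

theorem weak_mass (hT : ∀ t : ℝ, 0 ≤ t → ((t : EReal) < T ↔ 0 < f.X t))
    (h : IsTestOn quadrant φ) :
    WeakLimit n (fun ε => (f.wave n T).ρSW R ε)
      (fun ε p => (f.wave n T).ρSW R ε p * (f.wave n T).uSW R ε p) φ 0 := by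
  obtain ⟨C, hC⟩ := f.flux_bdd 0
  have := f.weakLimit_moment (n := n) hT 0 h (f.measurable_flux 0) hC fun t ht hF => by
    simpa using f.hasDerivAt_m ht hF
  simpa using this

theorem weak_momentum (hT : ∀ t : ℝ, 0 ≤ t → ((t : EReal) < T ↔ 0 < f.X t))
    (h : IsTestOn quadrant φ) :
    WeakLimit n (fun ε p => (f.wave n T).ρSW R ε p * (f.wave n T).uSW R ε p)
      (fun ε p => (f.wave n T).ρSW R ε p * (f.wave n T).uSW R ε p ^ 2) φ 0 := by
  obtain ⟨C, hC⟩ := f.flux_bdd 1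
  have := f.weakLimit_moment (n := n) hT 1 h (f.measurable_flux 1) hC fun t ht hF => by
    simpa using f.hasDerivAt_mv ht hF
  simpa using this

/-- The energy lost per unit time is half the sum of the two densities, each times the cube of its
velocity relative to the particle. Its sign is the entropy condition: matter can only run into the
wave. -/
theorem dissipative (hρl : 0 ≤ ρl) (hρr : 0 ≤ ρr)
    (hT : ∀ t : ℝ, 0 ≤ t → ((t : EReal) < T ↔ 0 < f.X t)) :
    (f.wave n T).IsDissipative n R := by
  intro φ h hφ
  obtain ⟨B, hB⟩ := f.v_bdd
  obtain ⟨C0, hC0⟩ := f.flux_bdd 0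
  obtain ⟨C1, hC1⟩ := f.flux_bdd 1
  have hB0 : 0 ≤ B := (abs_nonneg _).trans (hB 0)
  have key := f.weakLimit_moment (n := n) hT 2 h
    -- This is the derivative of `m * v ^ 2`, written as `2 v (m v)' - v ^ 2 m'` so that only
    -- bounded fluxes occur and no bound on the acceleration is needed.
    (D := fun t => 2 * f.v t * f.flux 1 t - f.v t ^ 2 * f.flux 0 t)
    (((f.v_cont.measurable.const_mul 2).mul (f.measurable_flux 1)).sub
      ((f.v_cont.measurable.pow_const 2).mul (f.measurable_flux 0)))
    (C := 2 * B * C1 + B ^ 2 * C0)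
    (fun t => by
      refine (abs_sub _ _).trans ?_
      rw [abs_mul, abs_mul, abs_mul, abs_pow, abs_two]
      have := hB t; have := hC0 t; have := hC1 t
      gcongr)
    (fun t ht hF => by
      have hm := f.hasDerivAt_m ht hF
      have hv := f.hasDerivAt_v ht hF
      have hmv := f.hasDerivAt_mv ht hF
      have e : f.flux 1 t = f.flux 0 t * f.v t + f.m t * deriv f.v t :=
        hmv.unique (hm.fun_mul hv)
      have h2 := hmv.fun_mul hv
      have e2 : (fun s => f.m s * f.v s ^ 2) = fun s => f.m s * f.v s * f.v s := by
        ext s; ring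
      rw [e2]
      refine h2.congr_deriv ?_
      simp only [e]; ring)
  have key2 := key.const_mul (1 / 2)
  refine ⟨_, ?_, by simpa only [mul_assoc] using key2⟩
  refine mul_nonpos_of_nonneg_of_nonpos (by norm_num) (integral_nonpos fun t => ?_)
  have hψ0 : 0 ≤ weighted n φ (f.X t, t) := by
    by_cases hp : (f.X t, t) ∈ quadrant
    · exact mul_nonneg (zpow_nonneg (le_of_lt hp.1) _) (hφ _)
    · rw [weighted_eq_zero h hp]
  rcases le_or_gt t 0 with ht | ht
  · simp [weighted_zero_time h ht]
  refine mul_nonpos_of_nonpos_of_nonneg ?_ hψ0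
  have e : 2 * (f.v t * f.flux 1 t) - f.v t ^ 2 * f.flux 0 t - f.flux 2 t
      = -(ρr * (f.v t - ur) ^ 3) - innerMass ρl ul f.X f.Y t * (ul - f.v t) ^ 3 := by
    simp only [flux, momentFlux]; ring
  refine e.trans_le ?_
  have h1 : 0 ≤ ρr * (f.v t - ur) ^ 3 :=
    mul_nonneg hρr (pow_nonneg (sub_nonneg.2 (f.v_ge t)) 3)
  have h2 : 0 ≤ innerMass ρl ul f.X f.Y t * (ul - f.v t) ^ 3 := by
    rcases f.Y_or with ⟨-, hv⟩ | ⟨hY, hv⟩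
    · refine mul_nonneg ?_ (pow_nonneg (sub_nonneg.2 (hv t)) 3)
      unfold innerMass
      split_ifs
      · exact hρl
      · exact le_rfl
    -- If the left state lags behind the particle, the difference `ul - v` is negative, but the
    -- particle borders on a vacuum.
    · have : f.Y t < f.X t := by rw [hY]; exact f.line_lt_X hv ht
      rw [innerMass, if_neg (fun hh => this.ne hh.1), zero_mul]
  linarith

end Front

/-! ### Lifetime of the wave and conditions at the origin -/

namespace Front

variable {R ρl ρr ul ur : ℝ} (f : Front R ρl ρr ul ur) {n : ℕ} {T : EReal}

theorem concave : ConcaveOn ℝ univ f.X := by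
  refine Antitone.concaveOn_univ_of_deriv (fun t => (f.X_deriv t).differentiableAt) ?_
  rw [funext fun t => (f.X_deriv t).deriv]
  exact f.v_anti

/-- A concave function that starts at `R > 0` and has a zero `t₀` is positive before it and cannot
become positive again. Thus the wave reaches the origin at most once, and `T` is that time or `⊤`.
-/
theorem exists_life (hR : 0 < R) : ∃ T : EReal, ∀ t : ℝ, 0 ≤ t → ((t : EReal) < T ↔ 0 < f.X t) := by
  by_cases hall : ∀ t, 0 ≤ t → 0 < f.X t
  · exact ⟨⊤, fun t ht => by simp [hall t ht]⟩
  push Not at hall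
  obtain ⟨t₂, ht₂, hX₂⟩ := hall
  obtain ⟨t₀, ht₀, hX₀⟩ : (0 : ℝ) ∈ f.X '' Icc 0 t₂ :=
    intermediate_value_Icc' ht₂ f.X_cont.continuousOn ⟨hX₂, by rw [f.X_zero]; exact hR.le⟩
  have hpos : 0 < t₀ := by
    refine lt_of_le_of_ne ht₀.1 fun h => ?_
    rw [← h, f.X_zero] at hX₀
    exact hR.ne' hX₀
  refine ⟨(t₀ : EReal), fun t ht => ?_⟩
  rw [EReal.coe_lt_coe_iff]
  constructor
  · intro h
    have := f.concave.2 (mem_univ 0) (mem_univ t₀)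
      (sub_nonneg.2 ((div_le_one hpos).2 h.le)) (by positivity : 0 ≤ t / t₀) (by ring)
    rw [f.X_zero, hX₀] at this
    simp only [smul_eq_mul, mul_zero, zero_add, add_zero, div_mul_cancel₀ _ hpos.ne'] at this
    refine lt_of_lt_of_le (mul_pos ?_ hR) this
    rw [sub_pos, div_lt_one hpos]
    exact h
  · intro h
    by_contra! hle
    -- If `X` were positive at some `t ≥ t₀`, concavity between `0` and `t` would force it to be
    -- positive at `t₀`.
    have htp : 0 < t := hpos.trans_le hle
    have := f.concave.2 (mem_univ 0) (mem_univ t)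
      (sub_nonneg.2 ((div_le_one htp).2 hle)) (by positivity : 0 ≤ t₀ / t) (by ring)
    rw [f.X_zero] at this
    simp only [smul_eq_mul, mul_zero, zero_add, div_mul_cancel₀ _ htp.ne', hX₀] at this
    have h1 : 0 ≤ (1 - t₀ / t) * R :=
      mul_nonneg (sub_nonneg.2 ((div_le_one htp).2 hle)) hR.le
    have h2 : 0 < t₀ / t * f.X t := by positivity
    linarith

theorem contDiff_X : ContDiff ℝ 1 f.X := by
  rw [contDiff_one_iff_deriv]
  refine ⟨fun t => (f.X_deriv t).differentiableAt, ?_⟩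
  rw [funext fun t => (f.X_deriv t).deriv]
  exact f.v_cont

theorem dens_of_X_lt {p : ℝ × ℝ} (h : f.X p.2 < p.1) : f.dens p = ρr := if_pos h

theorem vel_of_X_lt {p : ℝ × ℝ} (h : f.X p.2 < p.1) : f.vel p = ur := if_pos h

theorem vel_of_le_X {p : ℝ × ℝ} (h : p.1 ≤ f.X p.2) : f.vel p = ul := if_neg h.not_gt

theorem dens_of_le_Y {p : ℝ × ℝ} (h : p.1 ≤ f.X p.2) (h1 : p.1 ≤ f.Y p.2)
    (h2 : ul * p.2 < p.1) : f.dens p = ρl := by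
  rw [dens, if_neg h.not_gt, if_pos ⟨h2, h1⟩]

theorem dens_of_Y_lt {p : ℝ × ℝ} (h : p.1 ≤ f.X p.2) (h1 : f.Y p.2 < p.1) :
    f.dens p = 0 := by
  rw [dens, if_neg h.not_gt, if_neg fun hh => hh.2.not_gt h1]

theorem dens_of_le_line {p : ℝ × ℝ} (h : p.1 ≤ f.X p.2) (h1 : p.1 ≤ ul * p.2) :
    f.dens p = 0 := by
  rw [dens, if_neg h.not_gt, if_neg fun hh => h1.not_gt hh.1]

theorem dens_of_left_zero (h0 : ρl = 0) {p : ℝ × ℝ} (h : p.1 ≤ f.X p.2) : f.dens p = 0 := by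
  rw [dens, if_neg h.not_gt]
  split_ifs
  exacts [h0, rfl]

theorem eventually_lt_left {g : ℝ → ℝ} (hg : Continuous g) {r t : ℝ} (h : g t < r) :
    ∀ᶠ p in 𝓝 (r, t), g p.2 < p.1 :=
  ContinuousAt.eventually_lt (f := fun p : ℝ × ℝ => g p.2) (by fun_prop) continuousAt_fst h

theorem eventually_lt_right {g : ℝ → ℝ} (hg : Continuous g) {r t : ℝ} (h : r < g t) :
    ∀ᶠ p in 𝓝 (r, t), p.1 < g p.2 :=
  ContinuousAt.eventually_lt (g := fun p : ℝ × ℝ => g p.2) continuousAt_fst (by fun_prop) h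

/-- Off the crossing times the order of `X`, `Y` and `ul * t` is stable near `t`, so the state
behind the particle is locally constant. Without left matter crossings are invisible, and no time
needs to be excluded. -/
theorem inner_state {t : ℝ} (ht : 0 < t) (hF : ρl = 0 ∨ t ∉ f.F) :
    ∀ᶠ p in 𝓝 (f.X t, t), p.1 ≤ f.X p.2 →
      f.dens p = innerMass ρl ul f.X f.Y t ∧ f.vel p = ul := by
  rcases hF with h0 | hF
  · refine Eventually.of_forall fun p hp => ⟨?_, f.vel_of_le_X hp⟩
    rw [f.dens_of_left_zero h0 hp, innerMass]
    split_ifs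
    exacts [h0.symm, rfl]
  have hc := f.cross t hF
  rcases f.Y_or with ⟨h, -⟩ | ⟨h, hv⟩
  · rw [h] at hc
    rcases lt_or_gt_of_ne hc with h1 | h1
    · filter_upwards [eventually_lt_right (g := fun t => ul * t) (by fun_prop) h1] with p hp hpX
      refine ⟨?_, f.vel_of_le_X hpX⟩
      rw [f.dens_of_le_line hpX hp.le, innerMass, if_neg fun hh => hh.2.not_gt h1]
    · filter_upwards [eventually_lt_left (g := fun t => ul * t) (by fun_prop) h1] with p hp hpX
      refine ⟨?_, f.vel_of_le_X hpX⟩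
      rw [f.dens_of_le_Y hpX (by rwa [h]) hp, innerMass, if_pos ⟨by rw [h], h1⟩]
  · have hlt : f.Y t < f.X t := by rw [h]; exact f.line_lt_X hv ht
    filter_upwards [eventually_lt_left f.Y_cont hlt] with p hp hpX
    refine ⟨?_, f.vel_of_le_X hpX⟩
    rw [f.dens_of_Y_lt hpX hp, innerMass, if_neg fun hh => hlt.ne hh.1]

theorem hasSides_X {t : ℝ} (ht : 0 < t) (hF : ρl = 0 ∨ t ∉ f.F) (hX : 0 < f.X t) :
    HasSides (f.wave n T).ρ (f.wave n T).u f.X t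
      (fun p => p.1 ^ (1 - (n : ℤ)) * innerMass ρl ul f.X f.Y t) (fun _ => ul)
      (fun p => p.1 ^ (1 - (n : ℤ)) * ρr) (fun _ => ur) := by
  refine ⟨(contDiffAt_weight hX).mul contDiffAt_const, contDiffAt_const,
    (contDiffAt_weight hX).mul contDiffAt_const, contDiffAt_const, ?_⟩
  filter_upwards [f.inner_state ht hF] with p hp
  refine ⟨fun h => ?_, fun h => ?_⟩
  · obtain ⟨h1, h2⟩ := hp h.le
    exact ⟨by simp only [wave, h1], h2⟩
  · exact ⟨by simp only [wave, f.dens_of_X_lt h], f.vel_of_X_lt h⟩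

/-- With `σ = m * X ^ (1 - n)`, the derivative of the power of `X` cancels the source term, and the
plane balance laws remain, multiplied by `X ^ (1 - n)`. -/
theorem balanceAt {t : ℝ} (ht : 0 < t) (hF : t ∉ f.F) (hX : 0 < f.X t) :
    (f.wave n T).BalanceAt n R t := by
  have hk : HasDerivAt (fun s => f.X s ^ (1 - (n : ℤ)))
      (((1 - (n : ℤ) : ℤ) : ℝ) * f.X t ^ (1 - (n : ℤ) - 1) * f.v t) t :=
    (hasDerivAt_zpow _ _ (Or.inl hX.ne')).comp t (f.X_deriv t)
  have hkc : ContDiffAt ℝ 1 (fun s => f.X s ^ (1 - (n : ℤ))) t := by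
    have := (contDiffAt_weight (p := (f.X t, t)) (k := 1 - (n : ℤ)) (m := 1) hX).comp t
      (f := fun s => (f.X s, s)) (f.contDiff_X.contDiffAt.prodMk contDiffAt_id)
    exact this
  have hc : HasDerivAt (fun s => f.X s - R) (f.v t) t := (f.X_deriv t).sub_const R
  have hpos : (fun s => R + (f.wave n T).c s) = f.X := funext fun s => f.position_eq s
  refine ⟨_, _, _, _, by rw [hpos]; exact f.hasSides_X ht (Or.inr hF) hX,
    (f.m_smooth t ht hF).mul hkc, f.v_smooth t ht hF, ?_⟩
  dsimp only
  rw [f.position_eq]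
  have e0 : deriv (f.wave n T).σ t = _ := ((f.hasDerivAt_m ht hF).fun_mul hk).deriv
  have h1 := (f.hasDerivAt_mv ht hF).fun_mul hk
  have e1 : deriv (fun s => (f.wave n T).σ s * (f.wave n T).v s) t =
      deriv (fun s => f.m s * f.v s * f.X s ^ (1 - (n : ℤ))) t := by
    have : (fun s => (f.wave n T).σ s * (f.wave n T).v s)
        = fun s => f.m s * f.v s * f.X s ^ (1 - (n : ℤ)) := by
      ext s; simp only [wave]; ring
    rw [this]
  have e2 : deriv (f.wave n T).c t = f.v t := hc.deriv
  rw [e0, e1, h1.deriv, e2, zpow_sub_one₀ hX.ne']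
  simp only [wave, flux, momentFlux]
  push_cast
  constructor
  · field_simp
    ring
  · field_simp
    ring

theorem T_pos (hR : 0 < R) (hT : ∀ t : ℝ, 0 ≤ t → ((t : EReal) < T ↔ 0 < f.X t)) : 0 < T := by
  have := (hT 0 le_rfl).2 (by rwa [f.X_zero])
  simpa using this

theorem isSolutionAwayFromOrigin (hR : 0 < R)
    (hT : ∀ t : ℝ, 0 ≤ t → ((t : EReal) < T ↔ 0 < f.X t)) :
    (f.wave n T).IsSolutionAwayFromOrigin n R where
  lifetime_pos := f.T_pos hR hT
  start := by simp [wave, f.X_zero]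
  position_pos t ht := by rw [f.position_eq]; exact (hT t ht.1).1 ht.2
  velocity t _ := ((f.X_deriv t).sub_const R).hasDerivWithinAt
  velocity_cont := f.v_cont.continuousOn
  mass_cont := f.m_cont.continuousOn.mul (f.X_cont.continuousOn.zpow₀ _ fun t ht =>
    Or.inl ((hT t ht.1).1 ht.2).ne')
  left := by
    refine f.isWeakSolutionOn_of_avoids (fun p hp => ⟨hp.1, hp.2.1⟩) fun t h => ?_
    have := h.2.2.2
    rw [f.position_eq] at this
    exact lt_irrefl _ this
  right := by
    refine f.isWeakSolutionOn_of_avoids (fun p hp => ⟨hp.1, hp.2.1⟩) fun t h => ?_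
    have h1 := h.2.2 ((hT t (le_of_lt h.2.1)).2 h.1)
    rw [f.position_eq] at h1
    exact lt_irrefl _ h1
  balance := ⟨f.F, fun a b => f.F.finite_toSet.inter_of_left _, fun t ht ht0 hF =>
    f.balanceAt ht0 (by simpa using hF) ((hT t ht.1).1 ht.2)⟩
  weak_mass _ h := f.weak_mass hT h
  weak_momentum _ h := f.weak_momentum hT h

/-- The mass at the origin as long as the wave is present. -/
def massBefore (n : ℕ) (ρl ul R t : ℝ) : ℝ := sphereArea n * (ρl * max 0 (min R (-ul * t)))

theorem continuous_massBefore : Continuous (massBefore n ρl ul R) := by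
  unfold massBefore; fun_prop

/-- The mass at the origin after the absorption of the wave. -/
def massAfter (n : ℕ) (T t : ℝ) : ℝ :=
  sphereArea n * (ρl * max 0 (min R (-ul * T)) + f.m T + ρr * -ur * (t - T))

theorem continuous_massAfter (T : ℝ) : Continuous (f.massAfter n T) := by
  unfold massAfter; fun_prop

theorem originMass_before {t : ℝ} (h : (t : EReal) < T) :
    f.originMass n T t = massBefore n ρl ul R t := if_pos h

theorem originMass_after {t : ℝ} (h : T ≤ t) :
    f.originMass n T t = f.massAfter n T.toReal t := if_neg h.not_gt

theorem eventually_before {t : ℝ} (h : (t : EReal) < T) :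
    f.originMass n T =ᶠ[𝓝 t] massBefore n ρl ul R := by
  filter_upwards [continuous_coe_real_ereal.continuousAt.eventually_lt continuousAt_const h]
    with s hs using f.originMass_before hs

theorem eventually_after {t : ℝ} (h : T < t) :
    f.originMass n T =ᶠ[𝓝 t] f.massAfter n T.toReal := by
  filter_upwards [continuousAt_const.eventually_lt continuous_coe_real_ereal.continuousAt h]
    with s hs using f.originMass_after (le_of_lt hs)

theorem origin_cont : ContinuousOn (f.wave n T).m₀ {t | 0 ≤ t ∧ (t : EReal) ≠ (f.wave n T).T} := by
  intro t ht
  refine ContinuousAt.continuousWithinAt ?_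
  rcases lt_or_gt_of_ne ht.2 with h | h
  · exact (continuous_massBefore.continuousAt).congr (f.eventually_before h).symm
  · exact (f.continuous_massAfter _).continuousAt.congr (f.eventually_after h).symm

/-- The path stays at or above `R + ur * t`, so it can reach the origin only if `ur < 0`. Hence the
right state flows into the origin after the absorption. -/
theorem finite_life (hR : 0 < R) (hT : ∀ t : ℝ, 0 ≤ t → ((t : EReal) < T ↔ 0 < f.X t)) {t : ℝ}
    (h : T ≤ t) : ∃ t₀ : ℝ, T = t₀ ∧ 0 < t₀ ∧ t₀ ≤ t ∧ f.X t₀ = 0 ∧ ur < 0 := by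
  have hpos := f.T_pos hR hT
  induction T with
  | bot => simp at hpos
  | top => simp at h
  | coe t₀ =>
    have h0 : 0 < t₀ := by exact_mod_cast hpos
    have hle : f.X t₀ ≤ 0 := not_lt.1 fun hh => lt_irrefl _ ((hT t₀ h0.le).2 hh)
    have hge : 0 ≤ f.X t₀ := by
      refine ge_of_tendsto (f.X_cont.continuousAt.tendsto.mono_left nhdsWithin_le_nhds)
        (?_ : ∀ᶠ s in 𝓝[<] t₀, 0 ≤ f.X s)
      filter_upwards [self_mem_nhdsWithin, nhdsWithin_le_nhds (Ioi_mem_nhds h0)] with s hs hs0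
      exact ((hT s (le_of_lt hs0)).1 (EReal.coe_lt_coe_iff.2 hs)).le
    refine ⟨t₀, rfl, h0, EReal.coe_le_coe_iff.1 h, le_antisymm hle hge, ?_⟩
    have := f.line_le_X f.v_ge h0.le
    by_contra! hur
    have : 0 ≤ ur * t₀ := by positivity
    linarith

theorem absorbed (hR : 0 < R) (hT : ∀ t : ℝ, 0 ≤ t → ((t : EReal) < T ↔ 0 < f.X t)) {t₀ : ℝ}
    (h : (t₀ : EReal) = T) : (f.wave n T).AbsorbedAt n R t₀ := by
  obtain ⟨t₁, h1, h0, -, hX, -⟩ := f.finite_life hR hT h.ge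
  obtain rfl : t₀ = t₁ := by rw [h1] at h; exact_mod_cast h
  have hpos : (fun s => R + (f.wave n T).c s) = f.X := funext fun s => f.position_eq s
  have hm0 : (f.wave n T).m₀ = f.originMass n T := rfl
  refine ⟨?_, massBefore n ρl ul R t₀, sphereArea n * f.m t₀, ?_, ?_, ?_⟩
  · rw [hpos, ← hX]
    exact f.X_cont.continuousAt.tendsto.mono_left nhdsWithin_le_nhds
  · rw [hm0]
    refine (continuous_massBefore.continuousAt.tendsto.mono_left nhdsWithin_le_nhds).congr' ?_
    filter_upwards [self_mem_nhdsWithin] with s hs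
    rw [f.originMass_before (by rw [← h]; exact_mod_cast hs)]
  · refine ((f.m_cont.const_mul (sphereArea n)).continuousAt.tendsto.mono_left
      nhdsWithin_le_nhds).congr' ?_
    filter_upwards [self_mem_nhdsWithin, nhdsWithin_le_nhds (Ioi_mem_nhds h0)] with s hs hs0
    have hXs : 0 < f.X s := (hT s (le_of_lt hs0)).1 (by rw [← h]; exact_mod_cast hs)
    have hone : f.X s ^ (1 - (n : ℤ)) * f.X s ^ ((n : ℤ) - 1) = 1 := by
      rw [← zpow_add₀ hXs.ne']; simp
    rw [f.position_eq]
    simp only [wave]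
    linear_combination (-(sphereArea n * f.m s)) * hone
  · rw [hm0]
    have e : massBefore n ρl ul R t₀ + sphereArea n * f.m t₀ = f.massAfter n t₀ t₀ := by
      simp only [massBefore, massAfter]; ring
    rw [e]
    refine ((f.continuous_massAfter t₀).continuousAt.tendsto.mono_left
      nhdsWithin_le_nhds).congr' ?_
    filter_upwards [self_mem_nhdsWithin] with s hs
    rw [f.originMass_after (by rw [← h]; exact_mod_cast le_of_lt hs), ← h, EReal.toReal_coe]

/-- Constant plane states near the origin determine the boundary condition. -/
theorem boundaryConditionAt {t w a : ℝ} (hn : ∀ᶠ r in 𝓝[>] 0, f.dens (r, t) = a ∧ f.vel (r, t) = w)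
    (hw : 0 < w → a = 0) (hm : HasDerivAt (f.originMass n T) (-(sphereArea n * a * w)) t) :
    (f.wave n T).BoundaryConditionAt n t := by
  have hpow : ∀ r : ℝ, 0 < r → r ^ (1 - (n : ℤ)) * r ^ ((n : ℤ) - 1) = 1 := fun r hr => by
    rw [← zpow_add₀ hr.ne']; simp
  refine ⟨w, a, ?_, ?_, fun h => ⟨?_, ?_⟩, fun _ => ⟨sphereArea n * a * w, ?_, hm⟩⟩
  · refine tendsto_const_nhds.congr' ?_
    filter_upwards [hn] with r hr using hr.2.symm
  · refine tendsto_const_nhds.congr' ?_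
    filter_upwards [hn, self_mem_nhdsWithin] with r hr hr0
    simp only [wave, hr.1]
    linear_combination (-a) * hpow r hr0
  · rw [hw h, mul_zero, zero_mul, neg_zero] at hm
    exact hm
  · refine tendsto_const_nhds.congr' ?_
    filter_upwards [hn] with r hr
    simp [wave, hr.1, hw h]
  · refine tendsto_const_nhds.congr' ?_
    filter_upwards [hn, self_mem_nhdsWithin] with r hr hr0
    simp only [wave, hr.1, hr.2]
    linear_combination (-(sphereArea n * a * w)) * hpow r hr0

/-- Before `T` the origin sees the vacuum behind `ul * t` if `ul > 0`; otherwise it sees the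
incoming left state until a detached `Y` arrives, and then a vacuum. After `T` it sees the right
state. In each regime the explicit mass is affine in time with slope equal to the inflow. -/
theorem boundary (hR : 0 < R) (hT : ∀ t : ℝ, 0 ≤ t → ((t : EReal) < T ↔ 0 < f.X t)) {t : ℝ}
    (ht : 0 < t) (ht1 : (t : EReal) ≠ T) (ht2 : R + ul * t ≠ 0) :
    (f.wave n T).BoundaryConditionAt n t := by
  have hlt : ∀ {x : ℝ}, 0 < x → ∀ᶠ r : ℝ in 𝓝[>] 0, r < x := fun hx =>
    nhdsWithin_le_nhds (Iio_mem_nhds hx)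
  rcases lt_or_gt_of_ne ht1 with h | h
  · have hX := (hT t ht.le).1 h
    have hm0 := f.eventually_before (n := n) h
    rcases lt_or_ge 0 ul with hul | hul
    · refine f.boundaryConditionAt (w := ul) (a := 0) ?_ (fun _ => rfl) ?_
      · filter_upwards [hlt hX, hlt (mul_pos hul ht)] with r h1 h2
        exact ⟨f.dens_of_le_line h1.le h2.le, f.vel_of_le_X h1.le⟩
      · simp only [mul_zero, zero_mul, neg_zero]
        refine (hasDerivAt_const t (0 : ℝ)).congr_of_eventuallyEq ?_
        filter_upwards [hm0, Ioi_mem_nhds ht] with s hs hs0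
        have : -ul * s ≤ 0 := by have := mul_pos hul hs0; linarith
        rw [hs, massBefore, max_eq_left ((min_le_right _ _).trans this)]
        simp
    rcases lt_or_ge 0 (f.Y t) with hY | hY
    -- This makes `-ul * t` the active term of the minimum in `massBefore`: the left matter has not
    -- yet been used up.
    · have hlin : 0 < R + ul * t := by
        rcases f.Y_or with ⟨h', hv⟩ | ⟨h', hv⟩
        · exact hX.trans_le (f.X_le_line hv ht.le)
        · rwa [h'] at hY
      refine f.boundaryConditionAt (w := ul) (a := ρl) ?_ (fun h => absurd h hul.not_gt) ?_
      · filter_upwards [hlt hX, hlt hY, self_mem_nhdsWithin] with r h1 h2 h3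
        refine ⟨f.dens_of_le_Y h1.le h2.le ?_, f.vel_of_le_X h1.le⟩
        exact (mul_nonpos_of_nonpos_of_nonneg hul ht.le).trans_lt h3
      · have hd : HasDerivAt (fun s => sphereArea n * (ρl * (-ul * s)))
            (-(sphereArea n * ρl * ul)) t := by
          refine ((((hasDerivAt_id t).const_mul (-ul)).const_mul ρl).const_mul
            (sphereArea n)).congr_deriv ?_
          ring
        refine hd.congr_of_eventuallyEq ?_
        have hev : ∀ᶠ s in 𝓝 t, 0 < R + ul * s :=
          ContinuousAt.eventually_lt continuousAt_const (by fun_prop) hlin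
        filter_upwards [hm0, Ioi_mem_nhds ht, hev] with s hs hs0 hs1
        have h2 : 0 ≤ -ul * s := mul_nonneg (by linarith) (le_of_lt hs0)
        rw [hs, massBefore, min_eq_right (by linarith), max_eq_right h2]
    · rcases f.Y_or with ⟨h', hv⟩ | ⟨h', hv⟩
      · rw [h'] at hY; exact absurd hX hY.not_gt
      have hlin : R + ul * t < 0 := by
        rw [h'] at hY
        exact lt_of_le_of_ne hY ht2
      refine f.boundaryConditionAt (w := ul) (a := 0) ?_ (fun _ => rfl) ?_
      · filter_upwards [hlt hX, self_mem_nhdsWithin] with r h1 h3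
        exact ⟨f.dens_of_Y_lt h1.le (hY.trans_lt h3), f.vel_of_le_X h1.le⟩
      · simp only [mul_zero, zero_mul, neg_zero]
        refine (hasDerivAt_const t (sphereArea n * (ρl * R))).congr_of_eventuallyEq ?_
        have hev : ∀ᶠ s in 𝓝 t, R + ul * s < 0 :=
          ContinuousAt.eventually_lt (by fun_prop) continuousAt_const hlin
        filter_upwards [hm0, hev] with s hs hs1
        rw [hs, massBefore, min_eq_left (by linarith), max_eq_right hR.le]
  · obtain ⟨t₀, h1, h0, hle, hX, hur⟩ := f.finite_life hR hT (le_of_lt h)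
    have hXt : f.X t ≤ 0 := not_lt.1 fun hh => (((hT t ht.le).2 hh).trans h).false
    refine f.boundaryConditionAt (w := ur) (a := ρr) ?_ (fun h => absurd h hur.not_gt) ?_
    · filter_upwards [self_mem_nhdsWithin] with r hr
      have : f.X t < r := hXt.trans_lt hr
      exact ⟨f.dens_of_X_lt this, f.vel_of_X_lt this⟩
    · refine HasDerivAt.congr_of_eventuallyEq ?_ (f.eventually_after h)
      refine (((((hasDerivAt_id t).sub_const T.toReal).const_mul (ρr * -ur)).const_add
        (ρl * max 0 (min R (-ul * T.toReal)) + f.m T.toReal)).const_mul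
          (sphereArea n)).congr_deriv ?_
      ring

theorem isRadialSolution (hR : 0 < R)
    (hT : ∀ t : ℝ, 0 ≤ t → ((t : EReal) < T ↔ 0 < f.X t)) :
    (f.wave n T).IsRadialSolution n R where
  away := f.isSolutionAwayFromOrigin hR hT
  boundary := by
    -- The times when the wave and the end of a detached left state reach the origin. If `T = ⊤` or
    -- `ul = 0`, the corresponding default value is `0`, which excludes no positive time.
    refine ⟨{T.toReal, -R / ul}, fun a b => (Set.toFinite _).inter_of_left _, fun t ht hF => ?_⟩
    simp only [mem_insert_iff, mem_singleton_iff, not_or] at hF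
    refine f.boundary hR hT ht (fun h => hF.1 ?_) (fun h => hF.2 ?_)
    · rw [← h, EReal.toReal_coe]
    · have hul : ul ≠ 0 := by rintro rfl; simp at h; exact hR.ne' h
      field_simp
      linarith
  origin_cont := f.origin_cont
  absorbed _ h := f.absorbed hR hT h

theorem isPhysical (hρl : 0 ≤ ρl) (hρr : 0 ≤ ρr) (hR : 0 < R)
    (hT : ∀ t : ℝ, 0 ≤ t → ((t : EReal) < T ↔ 0 < f.X t)) : (f.wave n T).IsPhysical where
  wave t ht := mul_nonneg (f.m_nonneg t ht.1) (zpow_nonneg ((hT t ht.1).1 ht.2).le _)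
  regular r t hr _ := by
    refine mul_nonneg (zpow_nonneg hr.le _) ?_
    unfold dens
    split_ifs
    exacts [hρr, hρl, le_rfl]
  origin t ht := by
    have hS : 0 ≤ sphereArea n := measureReal_nonneg
    change 0 ≤ f.originMass n T t
    rcases lt_or_ge (t : EReal) T with h | h
    · rw [f.originMass_before h]
      exact mul_nonneg hS (mul_nonneg hρl (le_max_left _ _))
    · obtain ⟨t₀, h1, h0, hle, -, hur⟩ := f.finite_life hR hT h
      rw [f.originMass_after h, h1, EReal.toReal_coe]
      refine mul_nonneg hS (add_nonneg (add_nonneg (mul_nonneg hρl (le_max_left _ _))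
        (f.m_nonneg t₀ h0.le)) (mul_nonneg (mul_nonneg hρr (by linarith)) (by linarith)))

end Front

/-! ### Initial data -/

/-- At a fixed time, a value `a ε` on a strip of width `ε` acts in the limit as a point mass of
weight `A = lim ε * a ε`. For density and momentum `A` is `σ` and `σ * v`; for the velocity it is
zero. -/
theorem strip_integral_limit {H ψ : ℝ → ℝ} (hH : Integrable fun r => H r * ψ r)
    (hψ : Continuous ψ) (hψi : Integrable ψ) (x : ℝ) {a : ℝ → ℝ} {A : ℝ}
    (ha : Tendsto (fun ε => ε * a ε) (𝓝[>] 0) (𝓝 A)) {g : ℝ → ℝ → ℝ}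
    (hg : ∀ ε r, g ε r = {r | |r - x| < ε / 2}.indicator
      (fun r => a ε * ψ r - H r * ψ r) r + H r * ψ r) :
    (∀ ε, Integrable (g ε)) ∧
      Tendsto (fun ε => ∫ r, g ε r) (𝓝[>] 0) (𝓝 ((∫ r, H r * ψ r) + A * ψ x)) := by
  have hms : ∀ ε : ℝ, MeasurableSet {r : ℝ | |r - x| < ε / 2} := fun ε => by
    rw [strip_eq_Ioo]; exact measurableSet_Ioo
  have hd : ∀ ε, Integrable fun r => a ε * ψ r - H r * ψ r := fun ε => (hψi.const_mul _).sub hH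
  have hge : ∀ ε, g ε = fun r => {r | |r - x| < ε / 2}.indicator
      (fun r => a ε * ψ r - H r * ψ r) r + H r * ψ r := fun ε => funext (hg ε)
  refine ⟨fun ε => by rw [hge]; exact ((hd ε).indicator (hms ε)).add hH, ?_⟩
  have h0 : Tendsto (fun ε : ℝ => ∫ r in {r | |r - x| < ε / 2}, H r * ψ r) (𝓝[>] 0) (𝓝 0) := by
    refine Integrable.tendsto_setIntegral_nhds_zero hH ?_
    have : (fun ε : ℝ => volume {r : ℝ | |r - x| < ε / 2}) = fun ε => ENNReal.ofReal ε := by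
      ext ε
      rw [strip_eq_Ioo, Real.volume_Ioo]
      congr 1; ring
    change Tendsto (fun ε : ℝ => volume {r : ℝ | |r - x| < ε / 2}) _ _
    rw [this]
    have h1 := (ENNReal.continuous_ofReal.tendsto 0)
    rw [ENNReal.ofReal_zero] at h1
    exact h1.mono_left nhdsWithin_le_nhds
  have hlim := ((ha.mul (tendsto_strip_average hψ x)).sub h0).const_add (∫ r, H r * ψ r)
  rw [sub_zero] at hlim
  refine hlim.congr' ?_
  filter_upwards [self_mem_nhdsWithin] with ε hε
  have hε : ε ≠ 0 := ne_of_gt hε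
  rw [hge ε, integral_add ((hd ε).indicator (hms ε)) hH, integral_indicator (hms ε),
    integral_sub (hψi.const_mul _).integrableOn hH.integrableOn, integral_const_mul, add_comm]
  congr 2
  have : ε * (1 / ε) = 1 := by field_simp
  linear_combination (a ε * ∫ r in {r | |r - x| < ε / 2}, ψ r) * this

namespace Front

variable {R ρl ρr ul ur : ℝ} (f : Front R ρl ρr ul ur) {n : ℕ} {T : EReal}

/-- A family that consists of a thin strip around the wave and of a regular part attains the
initial values of its regular part if the strip disappears initially. -/
theorem attainsInitially (hR : 0 < R) (hT : ∀ t : ℝ, 0 ≤ t → ((t : EReal) < T ↔ 0 < f.X t))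
    {g : ℝ → ℝ × ℝ → ℝ} {g₀ : ℝ → ℝ} {K : ℝ × ℝ → ℝ} {w K₀ : ℝ → ℝ} {a : ℝ → ℝ → ℝ} {A : ℝ → ℝ}
    {C : ℝ}
    (hg : ∀ t ∈ (f.wave n T).life, ∀ ε r, g ε (r, t)
      = if |r - f.X t| < ε / 2 then a t ε else w r * K (r, t))
    (ha : ∀ t, Tendsto (fun ε => ε * a t ε) (𝓝[>] 0) (𝓝 (A t)))
    (hA : Tendsto A (𝓝[≥] 0) (𝓝 0)) (hw : ContinuousOn w (Ioi 0))
    (hK : ∀ t, Measurable fun r => K (r, t)) (hKC : ∀ p, |K p| ≤ C)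
    (hlim : ∀ r, 0 < r → r ≠ R → Tendsto (fun t => K (r, t)) (𝓝[≥] 0) (𝓝 (K₀ r)))
    (hg₀ : ∀ r, 0 < r → g₀ r = w r * K₀ r) (hK₀ : Measurable K₀) (hK₀C : ∀ r, |K₀ r| ≤ C) :
    ShadowWave.AttainsInitially g g₀ := by
  intro ψ h
  have hwc : Continuous fun r => w r * ψ r :=
    ContinuousOn.continuous_of_tsupport_subset (hw.mul h.1.continuous.continuousOn) isOpen_Ioi
      ((tsupport_mul_subset_right).trans h.2.2)
  have hwi : Integrable fun r => w r * ψ r := hwc.integrable_of_hasCompactSupport h.2.1.mul_left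
  have hψi : Integrable ψ := h.1.continuous.integrable_of_hasCompactSupport h.2.1
  have hz : ∀ r, r ∉ Ioi (0 : ℝ) → ψ r = 0 := fun r hr => h.eq_zero hr
  have h0i : Integrable fun r => w r * K₀ r * ψ r := by
    refine (hwi.bdd_mul hK₀.aestronglyMeasurable (ae_of_all _ hK₀C)).congr
      (ae_of_all _ fun r => ?_)
    ring
  have hKi : ∀ t, Integrable fun r => w r * K (r, t) * ψ r := fun t => by
    refine (hwi.bdd_mul (hK t).aestronglyMeasurable (ae_of_all _ fun r => hKC (r, t))).congr
      (ae_of_all _ fun r => ?_)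
    ring
  have hlife : ∀ᶠ t in 𝓝[≥] (0 : ℝ), t ∈ (f.wave n T).life := by
    have hXev : ∀ᶠ t in 𝓝 (0 : ℝ), 0 < f.X t :=
      continuousAt_const.eventually_lt f.X_cont.continuousAt (by rwa [f.X_zero])
    filter_upwards [self_mem_nhdsWithin, nhdsWithin_le_nhds hXev] with t ht hX
    exact ⟨ht, (hT t ht).2 hX⟩
  refine ⟨?_, fun t => (∫ r, w r * K (r, t) * ψ r) + A t * ψ (f.X t), ?_, ?_⟩
  · exact h0i.integrableOn.congr_fun (fun r hr => by simp only [hg₀ r hr]) measurableSet_Ioi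
  · filter_upwards [hlife] with t ht
    obtain ⟨h1, h2⟩ := strip_integral_limit (hKi t) h.1.continuous hψi (f.X t) (ha t)
      (g := fun ε r => g ε (r, t) * ψ r) (fun ε r => by
        rw [hg t ht]
        by_cases hs : |r - f.X t| < ε / 2
        · simp [hs]
        · simp [hs])
    refine ⟨Eventually.of_forall fun ε => (h1 ε).integrableOn, h2.congr fun ε => ?_⟩
    exact (setIntegral_eq_integral_of_forall_compl_eq_zero fun r hr => by simp [hz r hr]).symm
  · have e : ∫ r in Ioi 0, g₀ r * ψ r = (∫ r, w r * K₀ r * ψ r) + 0 * ψ (f.X 0) := by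
      rw [zero_mul, add_zero, setIntegral_congr_fun measurableSet_Ioi
        (g := fun r => w r * K₀ r * ψ r) (fun r hr => by simp only [hg₀ r hr])]
      exact setIntegral_eq_integral_of_forall_compl_eq_zero fun r hr => by simp [hz r hr]
    rw [e]
    refine Tendsto.add ?_ (hA.mul
      ((h.1.continuous.comp f.X_cont).continuousAt.tendsto.mono_left nhdsWithin_le_nhds))
    -- Pointwise convergence may fail at the initial position `r = R`, which is a null set.
    refine tendsto_integral_filter_of_dominated_convergence (fun r => C * |w r * ψ r|) ?_ ?_ ?_ ?_
    · exact Eventually.of_forall fun t => (hKi t).aestronglyMeasurable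
    · refine Eventually.of_forall fun t => ae_of_all _ fun r => ?_
      rw [Real.norm_eq_abs, mul_right_comm, abs_mul, mul_comm]
      exact mul_le_mul_of_nonneg_right (hKC _) (abs_nonneg _)
    · exact hwi.abs.const_mul C
    · filter_upwards [(countable_singleton R).ae_notMem volume] with r hr
      by_cases hr0 : 0 < r
      · exact ((hlim r hr0 hr).const_mul (w r)).mul_const (ψ r)
      · simp [hz r hr0]

theorem measurable_dens (t : ℝ) : Measurable fun r => f.dens (r, t) := by
  unfold dens
  exact Measurable.ite (measurableSet_Ioi (a := f.X t)) measurable_const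
    (Measurable.ite ((measurableSet_Ioi (a := ul * t)).inter (measurableSet_Iic (a := f.Y t)))
      measurable_const measurable_const)

theorem measurable_vel (t : ℝ) : Measurable fun r => f.vel (r, t) := by
  unfold vel
  exact Measurable.ite (measurableSet_Ioi (a := f.X t)) measurable_const measurable_const

theorem initial_state {r : ℝ} (hr : 0 < r) (hrR : r ≠ R) :
    ∀ᶠ t in 𝓝[≥] (0 : ℝ), f.dens (r, t) = (if r < R then ρl else ρr) ∧
      f.vel (r, t) = initialVelocity R ul ur r := by
  have hY0 : f.Y 0 = R := by
    rcases f.Y_or with ⟨h, -⟩ | ⟨h, -⟩ <;> rw [h]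
    · exact f.X_zero
    · simp
  refine nhdsWithin_le_nhds ?_
  rcases lt_or_gt_of_ne hrR with h | h
  · have h1 : ∀ᶠ t in 𝓝 (0 : ℝ), r < f.X t :=
      continuousAt_const.eventually_lt f.X_cont.continuousAt (by rwa [f.X_zero])
    have h2 : ∀ᶠ t in 𝓝 (0 : ℝ), r < f.Y t :=
      continuousAt_const.eventually_lt f.Y_cont.continuousAt (by rwa [hY0])
    have h3 : ∀ᶠ t in 𝓝 (0 : ℝ), ul * t < r :=
      ContinuousAt.eventually_lt (by fun_prop) continuousAt_const (by simpa)
    filter_upwards [h1, h2, h3] with t h1 h2 h3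
    rw [if_pos h, initialVelocity, if_pos h]
    exact ⟨f.dens_of_le_Y (le_of_lt h1) (le_of_lt h2) h3, f.vel_of_le_X (le_of_lt h1)⟩
  · have h1 : ∀ᶠ t in 𝓝 (0 : ℝ), f.X t < r :=
      f.X_cont.continuousAt.eventually_lt continuousAt_const (by rwa [f.X_zero])
    filter_upwards [h1] with t h1
    rw [if_neg h.not_gt, initialVelocity, if_neg h.not_gt]
    exact ⟨f.dens_of_X_lt h1, f.vel_of_X_lt h1⟩

theorem tendsto_σ (hR : 0 < R) :
    Tendsto (fun t => f.m t * f.X t ^ (1 - (n : ℤ))) (𝓝[≥] 0) (𝓝 0) := by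
  have hc : ContinuousAt (fun t => f.m t * f.X t ^ (1 - (n : ℤ))) 0 :=
    f.m_cont.continuousAt.mul (f.X_cont.continuousAt.zpow₀ _
      (Or.inl (by rw [f.X_zero]; exact hR.ne')))
  have := hc.tendsto
  rw [f.m_zero, zero_mul] at this
  exact this.mono_left nhdsWithin_le_nhds

theorem ρSW_eq {t : ℝ} (ht : t ∈ (f.wave n T).life) (ε r : ℝ) :
    (f.wave n T).ρSW R ε (r, t) = if |r - f.X t| < ε / 2 then f.m t * f.X t ^ (1 - (n : ℤ)) / ε
      else r ^ (1 - (n : ℤ)) * f.dens (r, t) := by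
  by_cases h : |r - f.X t| < ε / 2
  · rw [if_pos h]
    exact if_pos ⟨ht, by rwa [f.position_eq]⟩
  · rw [if_neg h]
    exact if_neg fun hh => h (by rw [← f.position_eq (n := n) (T := T)]; exact hh.2)

theorem uSW_eq {t : ℝ} (ht : t ∈ (f.wave n T).life) (ε r : ℝ) :
    (f.wave n T).uSW R ε (r, t) = if |r - f.X t| < ε / 2 then f.v t else f.vel (r, t) := by
  by_cases h : |r - f.X t| < ε / 2
  · rw [if_pos h]
    exact if_pos ⟨ht, by rwa [f.position_eq]⟩
  · rw [if_neg h]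
    exact if_neg fun hh => h (by rw [← f.position_eq (n := n) (T := T)]; exact hh.2)

theorem measurable_initial (a b : ℝ) : Measurable fun r : ℝ => if r < R then a else b :=
  Measurable.ite measurableSet_Iio measurable_const measurable_const

theorem hasInitialData (hR : 0 < R) (hT : ∀ t : ℝ, 0 ≤ t → ((t : EReal) < T ↔ 0 < f.X t)) :
    (f.wave n T).HasInitialData R (initialDensity n R ρl ρr) (initialVelocity R ul ur) where
  density := by
    have hw : ContinuousOn (fun r : ℝ => r ^ (1 - (n : ℤ))) (Ioi 0) :=
      continuousOn_id.zpow₀ _ fun r hr => Or.inl (ne_of_gt hr)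
    refine f.attainsInitially (n := n) hR hT (w := fun r => r ^ (1 - (n : ℤ))) (K := f.dens)
      (K₀ := fun r => if r < R then ρl else ρr)
      (a := fun t ε => f.m t * f.X t ^ (1 - (n : ℤ)) / ε)
      (A := fun t => f.m t * f.X t ^ (1 - (n : ℤ))) (C := |ρr| + |ρl|)
      (fun t ht ε r => ?_) (fun t => ?_) (f.tendsto_σ hR) hw f.measurable_dens (fun p => ?_)
      (fun r hr hrR => ?_) (fun r _ => mul_comm _ _) (measurable_initial _ _) fun r => ?_
    · exact f.ρSW_eq ht ε r
    · refine tendsto_const_nhds.congr' ?_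
      filter_upwards [self_mem_nhdsWithin] with ε hε
      exact (mul_div_cancel₀ _ (ne_of_gt hε)).symm
    · simpa using f.abs_dens_mul_le 0 p
    · refine tendsto_const_nhds.congr' ?_
      filter_upwards [f.initial_state hr hrR] with t ht using ht.1.symm
    · split_ifs
      · linarith [abs_nonneg ρr]
      · linarith [abs_nonneg ρl]
  velocity := by
    refine f.attainsInitially (n := n) hR hT (w := fun _ => 1) (K := f.vel) (K₀ := initialVelocity R ul ur)
      (a := fun t _ => f.v t) (A := fun _ => 0) (C := |ur| + |ul|)
      (fun t ht ε r => ?_) (fun t => ?_) tendsto_const_nhds continuousOn_const f.measurable_vel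
      (fun p => ?_) (fun r hr hrR => ?_) (fun r _ => (one_mul _).symm) (measurable_initial _ _)
      fun r => ?_
    · rw [one_mul]
      exact f.uSW_eq ht ε r
    · have : Tendsto (fun ε : ℝ => ε * f.v t) (𝓝 0) (𝓝 (0 * f.v t)) := by
        exact tendsto_id.mul_const _
      rw [zero_mul] at this
      exact this.mono_left nhdsWithin_le_nhds
    · unfold vel
      split_ifs
      · linarith [abs_nonneg ul]
      · linarith [abs_nonneg ur]
    · refine tendsto_const_nhds.congr' ?_
      filter_upwards [f.initial_state hr hrR] with t ht using ht.2.symm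
    · unfold initialVelocity
      split_ifs
      · linarith [abs_nonneg ur]
      · linarith [abs_nonneg ul]
  momentum := by
    have hw : ContinuousOn (fun r : ℝ => r ^ (1 - (n : ℤ))) (Ioi 0) :=
      continuousOn_id.zpow₀ _ fun r hr => Or.inl (ne_of_gt hr)
    refine f.attainsInitially (n := n) hR hT (w := fun r => r ^ (1 - (n : ℤ)))
      (K := fun p => f.dens p * f.vel p)
      (K₀ := fun r => (if r < R then ρl else ρr) * initialVelocity R ul ur r)
      (a := fun t ε => f.m t * f.X t ^ (1 - (n : ℤ)) / ε * f.v t)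
      (A := fun t => f.m t * f.X t ^ (1 - (n : ℤ)) * f.v t) (C := |ρr * ur| + |ρl * ul|)
      (fun t ht ε r => ?_) (fun t => ?_) ?_ hw
      (fun t => (f.measurable_dens t).mul (f.measurable_vel t)) (fun p => ?_)
      (fun r hr hrR => ?_) (fun r _ => ?_) ((measurable_initial _ _).mul (measurable_initial _ _))
      fun r => ?_
    · rw [f.ρSW_eq ht, f.uSW_eq ht]
      split_ifs
      · rfl
      · exact mul_assoc _ _ _
    · refine tendsto_const_nhds.congr' ?_
      filter_upwards [self_mem_nhdsWithin] with ε hε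
      have : ε ≠ 0 := ne_of_gt hε
      field_simp
    · have := (f.tendsto_σ (n := n) hR).mul
        (f.v_cont.continuousAt.tendsto.mono_left (nhdsWithin_le_nhds (s := Ici 0)))
      rwa [zero_mul] at this
    · simpa using f.abs_dens_mul_le 1 p
    · refine tendsto_const_nhds.congr' ?_
      filter_upwards [f.initial_state hr hrR] with t ht
      rw [ht.1, ht.2]
    · simp only [initialDensity]; ring
    · unfold initialVelocity
      split_ifs
      · linarith [abs_nonneg (ρr * ur)]
      · linarith [abs_nonneg (ρl * ul)]
  origin := by
    change f.originMass n T 0 = 0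
    rw [f.originMass_before (by simpa using f.T_pos hR hT), massBefore, mul_zero,
      max_eq_left (min_le_right _ _)]
    simp

/-! ### Structure of the solution -/

theorem isClassicalAt_of_const {p : ℝ × ℝ} (hp : 0 < p.1) {a w : ℝ}
    (h : ∀ᶠ q in 𝓝 p, f.dens q = a ∧ f.vel q = w) :
    IsClassicalAt n (f.wave n T).ρ (f.wave n T).u p := by
  have hρ : ∀ᶠ q in 𝓝 p, (f.wave n T).ρ q = q.1 ^ (1 - (n : ℤ)) * a ∧ (f.wave n T).u q = w := by
    filter_upwards [h] with q hq
    exact ⟨by simp only [wave, hq.1], hq.2⟩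
  refine Or.inr ⟨?_, ?_, ?_⟩
  · exact ((contDiffAt_weight hp).mul contDiffAt_const).congr_of_eventuallyEq
      (hρ.mono fun q hq => hq.1)
  · exact (contDiffAt_const (c := w)).congr_of_eventuallyEq (hρ.mono fun q hq => hq.2)
  · filter_upwards [hρ.eventually_nhds, continuousAt_const.eventually_lt continuousAt_fst hp]
      with q hq hq0
    have key : ∀ j : ℕ, dt (fun z => (f.wave n T).ρ z * (f.wave n T).u z ^ j) q = 0 ∧
        dr (fun z => (f.wave n T).ρ z * (f.wave n T).u z ^ j) q
          = ((1 - (n : ℤ) : ℤ) : ℝ) * q.1 ^ (1 - (n : ℤ) - 1) * (a * w ^ j) := fun j => by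
      have e : (fun z => (f.wave n T).ρ z * (f.wave n T).u z ^ j)
          =ᶠ[𝓝 q] fun z => z.1 ^ (1 - (n : ℤ)) * (a * w ^ j) := by
        filter_upwards [hq] with z hz
        rw [hz.1, hz.2]; ring
      have h1 := dt_weight_mul (k := 1 - (n : ℤ)) hq0 (differentiableAt_const (a * w ^ j))
      have h2 := dr_weight_mul (k := 1 - (n : ℤ)) hq0 (differentiableAt_const (a * w ^ j))
      have h3 : fderiv ℝ (fun _ : ℝ × ℝ => a * w ^ j) q = 0 := by
        rw [fderiv_fun_const]; rfl
      rw [dt, dr, e.fderiv_eq]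
      rw [dt, dt, h3] at h1
      rw [dr, dr, h3] at h2
      rw [h1, h2]
      simp
    have k0 := key 0
    have k1 := key 1
    have k2 := key 2
    simp only [pow_zero, mul_one, pow_one] at k0 k1
    rw [hq.self_of_nhds.1, hq.self_of_nhds.2, k0.1, k1.1, k1.2, k2.2, zpow_sub_one₀ hq0.ne']
    push_cast
    constructor <;> · field_simp; ring

theorem isClassicalAt_of_vacuum {p : ℝ × ℝ} (h : ∀ᶠ q in 𝓝 p, f.dens q = 0) :
    IsClassicalAt n (f.wave n T).ρ (f.wave n T).u p := by
  refine Or.inl ?_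
  filter_upwards [h] with q hq
  simp only [wave, hq, mul_zero]

/-- On a line that separates two constant plane states, one of them a vacuum, the other moving with
the velocity of the line, there is a shock bounding a vacuum or a vacuum. -/
theorem vacuum_shock_or_classical {γ : ℝ → ℝ} {t a b wa wb : ℝ} (hγ : ContDiff ℝ 1 γ)
    (hr : 0 < γ t) (ha : 0 ≤ a) (hb : 0 ≤ b)
    (hl : ∀ᶠ p in 𝓝 (γ t, t), p.1 ≤ γ p.2 → f.dens p = a ∧ f.vel p = wa)
    (hg : ∀ᶠ p in 𝓝 (γ t, t), γ p.2 < p.1 → f.dens p = b ∧ f.vel p = wb)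
    (h : (a = 0 ∧ ∀ s, deriv γ s = wb) ∨ (b = 0 ∧ ∀ s, deriv γ s = wa)) :
    IsClassicalAt n (f.wave n T).ρ (f.wave n T).u (γ t, t) ∨
      IsVacuumShockAt (f.wave n T).ρ (f.wave n T).u (γ t) t := by
  have hpos : 0 < γ t ^ (1 - (n : ℤ)) := zpow_pos hr _
  have hs : HasSides (f.wave n T).ρ (f.wave n T).u γ t
      (fun p => p.1 ^ (1 - (n : ℤ)) * a) (fun _ => wa)
      (fun p => p.1 ^ (1 - (n : ℤ)) * b) (fun _ => wb) := by
    refine ⟨(contDiffAt_weight hr).mul contDiffAt_const, contDiffAt_const,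
      (contDiffAt_weight hr).mul contDiffAt_const, contDiffAt_const, ?_⟩
    filter_upwards [hl, hg] with p h1 h2
    exact ⟨fun h => ⟨by simp only [wave, (h1 h.le).1], (h1 h.le).2⟩,
      fun h => ⟨by simp only [wave, (h2 h).1], (h2 h).2⟩⟩
  by_cases hab : a = 0 ∧ b = 0
  · refine Or.inl (f.isClassicalAt_of_vacuum ?_)
    filter_upwards [hl, hg] with p h1 h2
    rcases le_or_gt p.1 (γ p.2) with h' | h'
    · rw [(h1 h').1, hab.1]
    · rw [(h2 h').1, hab.2]
  · refine Or.inr ⟨γ, _, _, _, _, hγ.contDiffAt, rfl, hs, ?_⟩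
    rcases h with ⟨h0, h1⟩ | ⟨h0, h1⟩
    · refine Or.inl ⟨Eventually.of_forall fun p => by simp [h0], mul_pos hpos
        (lt_of_le_of_ne hb fun hh => hab ⟨h0, hh.symm⟩), Eventually.of_forall fun s => (h1 s).symm⟩
    · refine Or.inr ⟨Eventually.of_forall fun p => by simp [h0], mul_pos hpos
        (lt_of_le_of_ne ha fun hh => hab ⟨hh.symm, h0⟩), Eventually.of_forall fun s => (h1 s).symm⟩

theorem deriv_line (R w s : ℝ) : deriv (fun t => R + w * t) s = w := by
  have := ((hasDerivAt_id s).const_mul w).const_add R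
  rw [mul_one] at this
  exact this.deriv

/-- Away from the particle the state can change only at the two ends of the left state, `ul * t` and
a detached `Y`. Both move with velocity `ul` and have a vacuum on the other side. -/
theorem structure_off_wave (hR : 0 < R) (hρl : 0 ≤ ρl) {r t : ℝ} (hr : 0 < r)
    (hX : r ≠ f.X t) :
    IsClassicalAt n (f.wave n T).ρ (f.wave n T).u (r, t) ∨
      ((r = ul * t ∨ r = f.Y t) ∧ IsVacuumShockAt (f.wave n T).ρ (f.wave n T).u r t) := by
  rcases lt_or_gt_of_ne hX with hX | hX
  swap
  · refine Or.inl (f.isClassicalAt_of_const hr ?_ (a := ρr) (w := ur))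
    filter_upwards [eventually_lt_left f.X_cont hX] with p hp
    exact ⟨f.dens_of_X_lt hp, f.vel_of_X_lt hp⟩
  have evX := eventually_lt_right f.X_cont hX
  rcases lt_trichotomy r (f.Y t) with hY | hY | hY
  · have evY := eventually_lt_right f.Y_cont hY
    rcases lt_trichotomy r (ul * t) with hl | hl | hl
    · refine Or.inl (f.isClassicalAt_of_vacuum ?_)
      filter_upwards [evX, eventually_lt_right (g := fun t => ul * t) (by fun_prop) hl] with p h1 h2
      exact f.dens_of_le_line h1.le h2.le
    · subst hl
      have := f.vacuum_shock_or_classical (n := n) (T := T) (γ := fun t => ul * t) (t := t)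
        (a := 0) (b := ρl) (wa := ul) (wb := ul) (by fun_prop) hr le_rfl hρl
        (by filter_upwards [evX] with p h1 h2 using ⟨f.dens_of_le_line h1.le h2, f.vel_of_le_X h1.le⟩)
        (by filter_upwards [evX, evY] with p h1 h2 h3 using
          ⟨f.dens_of_le_Y h1.le h2.le h3, f.vel_of_le_X h1.le⟩)
        (Or.inl ⟨rfl, fun s => by simp⟩)
      exact this.imp_right fun h => ⟨Or.inl rfl, h⟩
    · refine Or.inl (f.isClassicalAt_of_const hr ?_ (a := ρl) (w := ul))
      filter_upwards [evX, evY, eventually_lt_left (g := fun t => ul * t) (by fun_prop) hl]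
        with p h1 h2 h3
      exact ⟨f.dens_of_le_Y h1.le h2.le h3, f.vel_of_le_X h1.le⟩
  · rcases f.Y_or with ⟨h', -⟩ | ⟨h', -⟩
    · rw [h'] at hY; exact absurd hY hX.ne
    have hl : ul * t < r := by rw [hY, h']; linarith
    subst hY
    have e : f.Y t = (fun t => R + ul * t) t := by rw [h']
    have := f.vacuum_shock_or_classical (n := n) (T := T) (γ := f.Y) (t := t)
      (a := ρl) (b := 0) (wa := ul) (wb := ul) (by rw [h']; fun_prop) hr hρl le_rfl
      (by
        filter_upwards [evX, eventually_lt_left (g := fun t => ul * t) (by fun_prop) hl]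
          with p h1 h2 h3 using ⟨f.dens_of_le_Y h1.le h3 h2, f.vel_of_le_X h1.le⟩)
      (by filter_upwards [evX] with p h1 h2 using ⟨f.dens_of_Y_lt h1.le h2, f.vel_of_le_X h1.le⟩)
      (Or.inr ⟨rfl, fun s => by rw [h']; exact deriv_line R ul s⟩)
    exact this.imp_right fun h => ⟨Or.inr rfl, h⟩
  · refine Or.inl (f.isClassicalAt_of_vacuum ?_)
    filter_upwards [evX, eventually_lt_left f.Y_cont hY] with p h1 h2
    exact f.dens_of_Y_lt h1.le h2

/-- A front without mass is a contact discontinuity or bounds a vacuum. -/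
theorem structure_massless (hρl : 0 ≤ ρl) (hρr : 0 ≤ ρr) {t : ℝ} (ht : 0 < t) (hX : 0 < f.X t)
    (hF : ρl = 0 ∨ t ∉ f.F) (hl : innerMass ρl ul f.X f.Y t = 0 ∨ ∀ s, f.v s = ul)
    (hr : ρr = 0 ∨ ∀ s, f.v s = ur) :
    IsClassicalAt n (f.wave n T).ρ (f.wave n T).u (f.X t, t) ∨
      IsVacuumShockAt (f.wave n T).ρ (f.wave n T).u (f.X t) t ∨
      IsContactAt (f.wave n T).ρ (f.wave n T).u (f.X t) t := by
  have hd : ∀ s, deriv f.X s = f.v s := fun s => (f.X_deriv s).deriv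
  have hin := f.inner_state ht hF
  have hout : ∀ᶠ p in 𝓝 (f.X t, t), f.X p.2 < p.1 → f.dens p = ρr ∧ f.vel p = ur :=
    Eventually.of_forall fun p hp => ⟨f.dens_of_X_lt hp, f.vel_of_X_lt hp⟩
  have hPl : 0 ≤ innerMass ρl ul f.X f.Y t := by
    unfold innerMass
    split_ifs
    exacts [hρl, le_rfl]
  have hshock := f.vacuum_shock_or_classical (n := n) (T := T) f.contDiff_X hX hPl hρr hin hout
  by_cases hl0 : innerMass ρl ul f.X f.Y t = 0
  · rcases hr with hr | hr
    · refine Or.inl (f.isClassicalAt_of_vacuum ?_)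
      filter_upwards [hin] with p hp
      rcases le_or_gt p.1 (f.X p.2) with h' | h'
      · rw [(hp h').1, hl0]
      · rw [f.dens_of_X_lt h', hr]
    · exact (hshock (Or.inl ⟨hl0, fun s => (hd s).trans (hr s)⟩)).imp_right Or.inl
  have hl := hl.resolve_left hl0
  by_cases hr0 : ρr = 0
  · exact (hshock (Or.inr ⟨hr0, fun s => (hd s).trans (hl s)⟩)).imp_right Or.inl
  have hr := hr.resolve_left hr0
  by_cases heq : innerMass ρl ul f.X f.Y t = ρr
  · refine Or.inl (f.isClassicalAt_of_const hX ?_ (a := ρr) (w := ur))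
    filter_upwards [hin] with p hp
    rcases le_or_gt p.1 (f.X p.2) with h' | h'
    · rw [(hp h').1, (hp h').2, heq, ← hl 0, hr 0]
      exact ⟨rfl, rfl⟩
    · exact ⟨f.dens_of_X_lt h', f.vel_of_X_lt h'⟩
  · have hpos : 0 < f.X t ^ (1 - (n : ℤ)) := zpow_pos hX _
    refine Or.inr (Or.inr ⟨f.X, _, _, _, _, f.contDiff_X.contDiffAt, rfl, f.hasSides_X ht hF hX,
      mul_pos hpos (lt_of_le_of_ne hPl (Ne.symm hl0)),
      mul_pos hpos (lt_of_le_of_ne hρr (Ne.symm hr0)),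
      fun h => heq (mul_left_cancel₀ hpos.ne' h), Eventually.of_forall fun s => ?_⟩)
    exact ⟨((hd s).trans (hl s)).symm, ((hd s).trans (hr s)).symm⟩

/-- The three possible vacuum shocks are `ul * t`, `Y` and a massless `X`; the only possible contact
is a massless `X`. Filtering these candidates leaves the genuine ones, since at the discarded points
the state is classical or the wave has mass. -/
theorem consistsOfAtMost (hR : 0 < R) (hρl : 0 ≤ ρl) (hρr : 0 ≤ ρr)
    (hT : ∀ t : ℝ, 0 ≤ t → ((t : EReal) < T ↔ 0 < f.X t)) {t : ℝ} (ht : 0 < t)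
    (h : 0 < f.m t ∨ ((ρl = 0 ∨ t ∉ f.F) ∧
      (innerMass ρl ul f.X f.Y t = 0 ∨ ∀ s, f.v s = ul) ∧ (ρr = 0 ∨ ∀ s, f.v s = ur))) :
    (f.wave n T).ConsistsOfAtMost n R 1 3 t := by
  classical
  refine ⟨({f.X t} : Finset ℝ).filter
      (fun r => 0 < r ∧ IsContactAt (f.wave n T).ρ (f.wave n T).u r t),
    ({ul * t, f.Y t, f.X t} : Finset ℝ).filter
      (fun r => 0 < r ∧ IsVacuumShockAt (f.wave n T).ρ (f.wave n T).u r t),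
    (Finset.card_filter_le _ _).trans (by simp),
    (Finset.card_filter_le _ _).trans Finset.card_le_three,
    fun r hr => (Finset.mem_filter.1 hr).2, fun r hr => (Finset.mem_filter.1 hr).2,
    fun r hr hK hV => ?_⟩
  simp only [Finset.mem_filter, Finset.mem_singleton, Finset.mem_insert, not_and] at hK hV
  by_cases hX : r = f.X t
  · subst hX
    rcases h with hm | ⟨hF, hl, hr'⟩
    · refine Or.inl ⟨⟨ht.le, (hT t ht.le).2 hr⟩, (f.position_eq t).symm, ?_⟩
      exact mul_pos hm (zpow_pos hr _)
    · rcases f.structure_massless (n := n) (T := T) hρl hρr ht hr hF hl hr' with h | h | h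
      · exact Or.inr h
      · exact absurd h (hV (Or.inr (Or.inr rfl)) hr)
      · exact absurd h (hK rfl hr)
  · rcases f.structure_off_wave (n := n) (T := T) hR hρl hr hX with h | ⟨h1, h2⟩
    · exact Or.inr h
    · refine absurd h2 (hV ?_ hr)
      rcases h1 with h1 | h1
      · exact Or.inl h1
      · exact Or.inr (Or.inl h1)

end Front

/-! ### Massless fronts -/

/-- A front of constant velocity that carries no mass. -/
def masslessFront (R ρl ρr ul ur w : ℝ) (Y : ℝ → ℝ) (F : Finset ℝ) (hw : ur ≤ w)
    (hY : (Y = (fun t => R + w * t) ∧ w ≤ ul) ∨ (Y = (fun t => R + ul * t) ∧ ul < w))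
    (hF : ∀ t ∉ F, Y t ≠ ul * t)
    (hflux : ∀ j t, 0 < t →
      momentFlux ρl ρr ul ur (fun t => R + w * t) (fun _ => w) Y j t = 0) :
    Front R ρl ρr ul ur where
  X := fun t => R + w * t
  v := fun _ => w
  m := fun _ => 0
  Y := Y
  F := F
  X_zero := by simp
  X_deriv t := by simpa using ((hasDerivAt_id t).const_mul w).const_add R
  v_cont := continuous_const
  v_anti := antitone_const
  v_ge _ := hw
  v_le := ⟨w, fun _ => le_rfl⟩
  Y_or := hY.imp (fun h => ⟨h.1, fun _ => h.2⟩) (fun h => ⟨h.1, fun _ => h.2⟩)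
  cross := hF
  m_zero := rfl
  m_nonneg _ _ := le_rfl
  m_cont := continuous_const
  m_smooth _ _ _ := contDiffAt_const
  v_smooth _ _ _ := contDiffAt_const
  mass t ht _ := by rw [hflux 0 t ht]; simp
  momentum t ht _ := by rw [hflux 1 t ht]; simp

/-! ### Collision of two states with matter, of densities `a ^ 2` and `b ^ 2` -/

section Delta

/-- The time at which the wave has absorbed all the matter inside. -/
def exhaustionTime (R a b d : ℝ) : ℝ := R * (a + b) / (b * d)

/-- The plane mass of the wave, after the exhaustion of the matter inside. -/
def lateMass (R a b d t : ℝ) : ℝ :=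
  √(a ^ 2 * R * (R * (a ^ 2 - b ^ 2) + 2 * b ^ 2 * d * max t (exhaustionTime R a b d)))

variable {R a b d ul ur : ℝ}

theorem exhaustionTime_pos (hR : 0 < R) (ha : 0 < a) (hb : 0 < b) (hd : 0 < d) :
    0 < exhaustionTime R a b d := by unfold exhaustionTime; positivity

/-- The additive constant in `lateMass` is chosen so that the late mass starts with the early mass
`a * b * d * t` reached at the exhaustion time, which is `a * R * (a + b)`. -/
theorem lateMass_radicand (hd : 0 < d) :
    a ^ 2 * R * (R * (a ^ 2 - b ^ 2) + 2 * b ^ 2 * d * exhaustionTime R a b d)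
      = (a * R * (a + b)) ^ 2 := by
  unfold exhaustionTime
  field_simp
  ring

theorem lateMass_radicand_ge (hR : 0 < R) (ha : 0 < a) (hb : 0 < b) (hd : 0 < d) {t : ℝ}
    (ht : exhaustionTime R a b d ≤ t) :
    (a * R * (a + b)) ^ 2 ≤ a ^ 2 * R * (R * (a ^ 2 - b ^ 2) + 2 * b ^ 2 * d * t) := by
  rw [← lateMass_radicand hd]
  gcongr

theorem lateMass_of_le (hR : 0 < R) (ha : 0 < a) (hb : 0 < b) (hd : 0 < d) {t : ℝ}
    (ht : t ≤ exhaustionTime R a b d) : lateMass R a b d t = a * R * (a + b) := by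
  rw [lateMass, max_eq_right ht, lateMass_radicand hd, Real.sqrt_sq (by positivity)]

theorem lateMass_monotone (hR : 0 < R) (hd : 0 < d) : Monotone (lateMass R a b d) := fun s t h => by
  unfold lateMass
  gcongr

theorem lateMass_ge (hR : 0 < R) (ha : 0 < a) (hb : 0 < b) (hd : 0 < d) (t : ℝ) :
    a * R * (a + b) ≤ lateMass R a b d t := by
  unfold lateMass
  exact Real.le_sqrt_of_sq_le (lateMass_radicand_ge hR ha hb hd (le_max_right _ _))

theorem lateMass_pos (hR : 0 < R) (ha : 0 < a) (hb : 0 < b) (hd : 0 < d) (t : ℝ) :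
    0 < lateMass R a b d t :=
  lt_of_lt_of_le (by positivity) (lateMass_ge hR ha hb hd t)

theorem continuous_lateMass : Continuous (lateMass R a b d) := by
  unfold lateMass; fun_prop

theorem lateMass_eventually_early (hR : 0 < R) (ha : 0 < a) (hb : 0 < b) (hd : 0 < d) {t : ℝ}
    (ht : t < exhaustionTime R a b d) :
    lateMass R a b d =ᶠ[𝓝 t] fun _ => a * R * (a + b) := by
  filter_upwards [Iio_mem_nhds ht] with s hs using lateMass_of_le hR ha hb hd (le_of_lt hs)

theorem lateMass_eventually_late {t : ℝ} (ht : exhaustionTime R a b d < t) :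
    lateMass R a b d =ᶠ[𝓝 t]
      fun s => √(a ^ 2 * R * (R * (a ^ 2 - b ^ 2) + 2 * b ^ 2 * d * s)) := by
  filter_upwards [Ioi_mem_nhds ht] with s hs
  rw [lateMass, max_eq_left (le_of_lt hs)]

theorem contDiffAt_lateMass (hR : 0 < R) (ha : 0 < a) (hb : 0 < b) (hd : 0 < d) {t : ℝ}
    (ht : t ≠ exhaustionTime R a b d) : ContDiffAt ℝ 1 (lateMass R a b d) t := by
  rcases lt_or_gt_of_ne ht with h | h
  · exact contDiffAt_const.congr_of_eventuallyEq (lateMass_eventually_early hR ha hb hd h)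
  · refine ContDiffAt.congr_of_eventuallyEq ?_ (lateMass_eventually_late h)
    refine ContDiffAt.sqrt (by fun_prop) (ne_of_gt ?_)
    exact lt_of_lt_of_le (by positivity) (lateMass_radicand_ge hR ha hb hd h.le)

/-- This is `m' = b ^ 2 * (v - ur)` combined with the conserved relative momentum `m * (v - ur) = a
^ 2 * R * d`, that of all the matter initially inside. -/
theorem hasDerivAt_lateMass (hR : 0 < R) (ha : 0 < a) (hb : 0 < b) (hd : 0 < d) {t : ℝ}
    (ht : exhaustionTime R a b d < t) :
    HasDerivAt (lateMass R a b d) (a ^ 2 * b ^ 2 * R * d / lateMass R a b d t) t := by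
  refine HasDerivAt.congr_of_eventuallyEq ?_ (lateMass_eventually_late ht)
  have h1 : HasDerivAt (fun s => a ^ 2 * R * (R * (a ^ 2 - b ^ 2) + 2 * b ^ 2 * d * s))
      (a ^ 2 * R * (2 * b ^ 2 * d)) t := by
    simpa using (((hasDerivAt_id t).const_mul (2 * b ^ 2 * d)).const_add
      (R * (a ^ 2 - b ^ 2))).const_mul (a ^ 2 * R)
  refine (h1.sqrt (ne_of_gt ?_)).congr_deriv ?_
  · exact lt_of_lt_of_le (by positivity) (lateMass_radicand_ge hR ha hb hd ht.le)
  · rw [(lateMass_eventually_late ht).self_of_nhds, mul_div_assoc, mul_div_assoc]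
    field_simp

/-- The velocity of the wave between two states with matter. -/
def deltaVelocity (R a b ul ur t : ℝ) : ℝ :=
  ur + a ^ 2 * R * (ul - ur) / lateMass R a b (ul - ur) t

/-- The position of the wave between two states with matter. -/
def deltaPosition (R a b ul ur t : ℝ) : ℝ := R + ∫ s in (0 : ℝ)..t, deltaVelocity R a b ul ur s

/-- The plane mass of the wave between two states with matter. -/
def deltaMass (R a b d t : ℝ) : ℝ :=
  a * b * d * min t (exhaustionTime R a b d) + lateMass R a b d t - a * R * (a + b)

theorem continuous_deltaVelocity (hR : 0 < R) (ha : 0 < a) (hb : 0 < b) (hd : 0 < ul - ur) :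
    Continuous (deltaVelocity R a b ul ur) :=
  continuous_const.add (continuous_const.div continuous_lateMass fun t =>
    (lateMass_pos hR ha hb hd t).ne')

theorem deltaVelocity_le (hR : 0 < R) (ha : 0 < a) (hb : 0 < b) (hd : 0 < ul - ur) (t : ℝ) :
    deltaVelocity R a b ul ur t ≤ ur + a * (ul - ur) / (a + b) := by
  have h : a ^ 2 * R * (ul - ur) / lateMass R a b (ul - ur) t
      ≤ a ^ 2 * R * (ul - ur) / (a * R * (a + b)) := by
    have := lateMass_ge hR ha hb hd t
    gcongr
  have e : a ^ 2 * R * (ul - ur) / (a * R * (a + b)) = a * (ul - ur) / (a + b) := by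
    field_simp
  rw [deltaVelocity]
  linarith

theorem early_velocity_lt (ha : 0 < a) (hb : 0 < b) (hd : 0 < ul - ur) :
    ur + a * (ul - ur) / (a + b) < ul := by
  have : a * (ul - ur) / (a + b) < ul - ur := by
    rw [div_lt_iff₀ (by positivity)]
    nlinarith [mul_pos hb hd]
  linarith

theorem deltaVelocity_of_le (hR : 0 < R) (ha : 0 < a) (hb : 0 < b) (hd : 0 < ul - ur) {t : ℝ}
    (ht : t ≤ exhaustionTime R a b (ul - ur)) :
    deltaVelocity R a b ul ur t = ur + a * (ul - ur) / (a + b) := by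
  rw [deltaVelocity, lateMass_of_le hR ha hb hd ht]
  field_simp

theorem hasDerivAt_deltaPosition (hR : 0 < R) (ha : 0 < a) (hb : 0 < b) (hd : 0 < ul - ur)
    (t : ℝ) : HasDerivAt (deltaPosition R a b ul ur) (deltaVelocity R a b ul ur t) t :=
  (intervalIntegral.integral_hasDerivAt_right
    ((continuous_deltaVelocity hR ha hb hd).intervalIntegrable _ _)
    ((continuous_deltaVelocity hR ha hb hd).stronglyMeasurableAtFilter _ _)
    (continuous_deltaVelocity hR ha hb hd).continuousAt).const_add R

/-- The particle is overtaken by the inner end `ul * t` of the left state. If `ul ≤ 0` this happens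
at a nonpositive position, hence not before the wave has reached the origin. -/
theorem deltaPosition_exhaustionTime (hR : 0 < R) (ha : 0 < a) (hb : 0 < b) (hd : 0 < ul - ur) :
    deltaPosition R a b ul ur (exhaustionTime R a b (ul - ur))
      = ul * exhaustionTime R a b (ul - ur) := by
  have ht := exhaustionTime_pos hR ha hb hd
  rw [deltaPosition, intervalIntegral.integral_congr (g := fun _ => ur + a * (ul - ur) / (a + b))
    fun s hs => deltaVelocity_of_le hR ha hb hd (by rw [uIcc_of_le ht.le] at hs; exact hs.2)]
  rw [intervalIntegral.integral_const, smul_eq_mul, sub_zero]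
  have hne : ul - ur ≠ 0 := hd.ne'
  unfold exhaustionTime
  field_simp
  ring

/-- The particle is always slower than `ul`, so it meets the line `ul * t` exactly once, at the
exhaustion time. -/
theorem strictAnti_deltaPosition_sub (hR : 0 < R) (ha : 0 < a) (hb : 0 < b) (hd : 0 < ul - ur) :
    StrictAnti fun t => deltaPosition R a b ul ur t - ul * t :=
  strictAnti_of_deriv_neg fun t => by
    have h : HasDerivAt (fun t => deltaPosition R a b ul ur t - ul * t)
        (deltaVelocity R a b ul ur t - ul) t := by
      simpa using (hasDerivAt_deltaPosition hR ha hb hd t).fun_sub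
        ((hasDerivAt_id t).const_mul ul)
    rw [h.deriv]
    linarith [deltaVelocity_le hR ha hb hd t, early_velocity_lt ha hb hd]

theorem line_lt_deltaPosition (hR : 0 < R) (ha : 0 < a) (hb : 0 < b) (hd : 0 < ul - ur) {t : ℝ}
    (ht : t < exhaustionTime R a b (ul - ur)) : ul * t < deltaPosition R a b ul ur t := by
  have := strictAnti_deltaPosition_sub hR ha hb hd ht
  simp only [deltaPosition_exhaustionTime hR ha hb hd, sub_self] at this
  linarith

theorem deltaPosition_lt_line (hR : 0 < R) (ha : 0 < a) (hb : 0 < b) (hd : 0 < ul - ur) {t : ℝ}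
    (ht : exhaustionTime R a b (ul - ur) < t) : deltaPosition R a b ul ur t < ul * t := by
  have := strictAnti_deltaPosition_sub hR ha hb hd ht
  simp only [deltaPosition_exhaustionTime hR ha hb hd, sub_self] at this
  linarith

theorem deltaMass_eventually_early (hR : 0 < R) (ha : 0 < a) (hb : 0 < b) (hd : 0 < d) {t : ℝ}
    (ht : t < exhaustionTime R a b d) : deltaMass R a b d =ᶠ[𝓝 t] fun s => a * b * d * s := by
  filter_upwards [Iio_mem_nhds ht] with s hs
  rw [deltaMass, lateMass_of_le hR ha hb hd (le_of_lt hs), min_eq_left (le_of_lt hs)]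
  ring

theorem deltaMass_eventually_late (hb : 0 < b) (hd : 0 < d) {t : ℝ}
    (ht : exhaustionTime R a b d < t) : deltaMass R a b d =ᶠ[𝓝 t] lateMass R a b d := by
  filter_upwards [Ioi_mem_nhds ht] with s hs
  have : a * b * d * exhaustionTime R a b d = a * R * (a + b) := by
    unfold exhaustionTime
    field_simp
  rw [deltaMass, min_eq_right (le_of_lt hs), this]
  ring

theorem deltaMass_pos (hR : 0 < R) (ha : 0 < a) (hb : 0 < b) (hd : 0 < d) {t : ℝ} (ht : 0 < t) :
    0 < deltaMass R a b d t := by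
  have h1 := lateMass_ge hR ha hb hd t
  have h2 : 0 < a * b * d * min t (exhaustionTime R a b d) :=
    mul_pos (by positivity) (lt_min ht (exhaustionTime_pos hR ha hb hd))
  rw [deltaMass]
  linarith

theorem deltaMass_zero (hR : 0 < R) (ha : 0 < a) (hb : 0 < b) (hd : 0 < d) :
    deltaMass R a b d 0 = 0 := by
  rw [(deltaMass_eventually_early hR ha hb hd (exhaustionTime_pos hR ha hb hd)).self_of_nhds]
  exact mul_zero _

theorem innerMass_early (hR : 0 < R) (ha : 0 < a) (hb : 0 < b) (hd : 0 < ul - ur) {t : ℝ}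
    (ht : t < exhaustionTime R a b (ul - ur)) (ρl : ℝ) :
    innerMass ρl ul (deltaPosition R a b ul ur) (deltaPosition R a b ul ur) t = ρl :=
  if_pos ⟨rfl, line_lt_deltaPosition hR ha hb hd ht⟩

theorem innerMass_late (hR : 0 < R) (ha : 0 < a) (hb : 0 < b) (hd : 0 < ul - ur) {t : ℝ}
    (ht : exhaustionTime R a b (ul - ur) < t) (ρl : ℝ) :
    innerMass ρl ul (deltaPosition R a b ul ur) (deltaPosition R a b ul ur) t = 0 :=
  if_neg fun h => h.2.not_gt (deltaPosition_lt_line hR ha hb hd ht)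

/-- Early, the particle's velocity relative to the right state is `a * d / (a + b)` and that of the
left state relative to it is `b * d / (a + b)`, where `d = ul - ur`; the two inflows add up to `a *
b * d`. Late, only the right one remains. -/
theorem deltaMass_balance (hR : 0 < R) (ha : 0 < a) (hb : 0 < b) (hd : 0 < ul - ur) {t : ℝ}
    (ht : t ≠ exhaustionTime R a b (ul - ur)) :
    deriv (deltaMass R a b (ul - ur)) t = momentFlux (a ^ 2) (b ^ 2) ul ur
      (deltaPosition R a b ul ur) (deltaVelocity R a b ul ur) (deltaPosition R a b ul ur) 0 t := by
  rcases lt_or_gt_of_ne ht with h | h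
  · have h1 : HasDerivAt (fun s => a * b * (ul - ur) * s) (a * b * (ul - ur)) t := by
      simpa using (hasDerivAt_id t).const_mul (a * b * (ul - ur))
    rw [(deltaMass_eventually_early hR ha hb hd h).deriv_eq, h1.deriv, momentFlux,
      innerMass_early hR ha hb hd h, deltaVelocity_of_le hR ha hb hd h.le]
    field_simp
    ring
  · rw [(deltaMass_eventually_late hb hd h).deriv_eq, (hasDerivAt_lateMass hR ha hb hd h).deriv,
      momentFlux, innerMass_late hR ha hb hd h, deltaVelocity]
    ring

theorem deltaMomentum_balance (hR : 0 < R) (ha : 0 < a) (hb : 0 < b) (hd : 0 < ul - ur) {t : ℝ}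
    (ht : t ≠ exhaustionTime R a b (ul - ur)) :
    deriv (fun s => deltaMass R a b (ul - ur) s * deltaVelocity R a b ul ur s) t
      = momentFlux (a ^ 2) (b ^ 2) ul ur (deltaPosition R a b ul ur)
        (deltaVelocity R a b ul ur) (deltaPosition R a b ul ur) 1 t := by
  rcases lt_or_gt_of_ne ht with h | h
  · have h1 : HasDerivAt (fun s => a * b * (ul - ur) * (ur + a * (ul - ur) / (a + b)) * s)
        (a * b * (ul - ur) * (ur + a * (ul - ur) / (a + b))) t := by
      simpa using (hasDerivAt_id t).const_mul
        (a * b * (ul - ur) * (ur + a * (ul - ur) / (a + b)))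
    have e : (fun s => deltaMass R a b (ul - ur) s * deltaVelocity R a b ul ur s) =ᶠ[𝓝 t]
        fun s => a * b * (ul - ur) * (ur + a * (ul - ur) / (a + b)) * s := by
      filter_upwards [deltaMass_eventually_early hR ha hb hd h, Iio_mem_nhds h] with s h1 h2
      rw [h1, deltaVelocity_of_le hR ha hb hd (le_of_lt h2)]
      ring
    rw [e.deriv_eq, h1.deriv, momentFlux, innerMass_early hR ha hb hd h,
      deltaVelocity_of_le hR ha hb hd h.le]
    field_simp
    ring
  · have h1 := ((hasDerivAt_lateMass hR ha hb hd h).const_mul ur).const_add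
      (a ^ 2 * R * (ul - ur))
    have e : (fun s => deltaMass R a b (ul - ur) s * deltaVelocity R a b ul ur s) =ᶠ[𝓝 t]
        -- The momentum splits into the conserved relative momentum and `ur` times the mass.
        fun s => a ^ 2 * R * (ul - ur) + ur * lateMass R a b (ul - ur) s := by
      filter_upwards [deltaMass_eventually_late hb hd h] with s h1
      have := (lateMass_pos hR ha hb hd s).ne'
      rw [h1, deltaVelocity]
      field_simp
      ring
    rw [e.deriv_eq, h1.deriv, momentFlux, innerMass_late hR ha hb hd h, deltaVelocity]
    ring

/-- The front between two colliding states with matter. -/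
def deltaFront (hR : 0 < R) (ha : 0 < a) (hb : 0 < b) (hd : 0 < ul - ur) :
    Front R (a ^ 2) (b ^ 2) ul ur where
  X := deltaPosition R a b ul ur
  v := deltaVelocity R a b ul ur
  m := deltaMass R a b (ul - ur)
  Y := deltaPosition R a b ul ur
  F := {exhaustionTime R a b (ul - ur)}
  X_zero := by simp [deltaPosition]
  X_deriv := hasDerivAt_deltaPosition hR ha hb hd
  v_cont := continuous_deltaVelocity hR ha hb hd
  v_anti s t h := by
    have h1 := lateMass_monotone (a := a) (b := b) hR hd h
    have h2 := lateMass_pos hR ha hb hd s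
    unfold deltaVelocity
    gcongr
  v_ge t := by
    have h2 := lateMass_pos hR ha hb hd t
    have : 0 ≤ a ^ 2 * R * (ul - ur) / lateMass R a b (ul - ur) t := by positivity
    rw [deltaVelocity]
    linarith
  v_le := ⟨_, deltaVelocity_le hR ha hb hd⟩
  Y_or := Or.inl ⟨rfl, fun t =>
    (deltaVelocity_le hR ha hb hd t).trans (early_velocity_lt ha hb hd).le⟩
  cross t ht := by
    rcases lt_or_gt_of_ne (by simpa using ht) with h | h
    · exact (line_lt_deltaPosition hR ha hb hd h).ne'
    · exact (deltaPosition_lt_line hR ha hb hd h).ne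
  m_zero := deltaMass_zero hR ha hb hd
  m_nonneg t ht := by
    rcases ht.eq_or_lt with rfl | h
    · rw [deltaMass_zero hR ha hb hd]
    · exact (deltaMass_pos hR ha hb hd h).le
  m_cont := by
    have := continuous_lateMass (R := R) (a := a) (b := b) (d := ul - ur)
    unfold deltaMass
    fun_prop
  m_smooth t _ ht := by
    rcases lt_or_gt_of_ne (by simpa using ht) with h | h
    · exact ContDiffAt.congr_of_eventuallyEq (by fun_prop)
        (deltaMass_eventually_early hR ha hb hd h)
    · exact (contDiffAt_lateMass hR ha hb hd h.ne').congr_of_eventuallyEq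
        (deltaMass_eventually_late hb hd h)
  v_smooth t _ ht := contDiffAt_const.add (contDiffAt_const.div
    (contDiffAt_lateMass hR ha hb hd (by simpa using ht)) (lateMass_pos hR ha hb hd t).ne')
  mass t _ ht := deltaMass_balance hR ha hb hd (by simpa using ht)
  momentum t _ ht := deltaMomentum_balance hR ha hb hd (by simpa using ht)

end Delta

/-! ### From fronts to solutions, and the choice of front -/

theorem Front.exists_solution {R ρl ρr ul ur : ℝ} (f : Front R ρl ρr ul ur) (n : ℕ) (hR : 0 < R)
    (hρl : 0 ≤ ρl) (hρr : 0 ≤ ρr)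
    (h : ∀ t, 0 < t → 0 < f.m t ∨ ((ρl = 0 ∨ t ∉ f.F) ∧
      (innerMass ρl ul f.X f.Y t = 0 ∨ ∀ s, f.v s = ul) ∧ (ρr = 0 ∨ ∀ s, f.v s = ur))) :
    ∃ S : ShadowWave, S.IsRadialSolution n R ∧
      S.HasInitialData R (initialDensity n R ρl ρr) (initialVelocity R ul ur) ∧
      S.IsPhysical ∧ S.IsDissipative n R ∧ ∀ t : ℝ, 0 < t → S.ConsistsOfAtMost n R 1 3 t := by
  obtain ⟨T, hT⟩ := f.exists_life hR
  exact ⟨f.wave n T, f.isRadialSolution hR hT, f.hasInitialData hR hT,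
    f.isPhysical hρl hρr hR hT, f.dissipative hρl hρr hT,
    fun t ht => f.consistsOfAtMost hR hρl hρr hT ht (h t ht)⟩

theorem innerMass_eq_zero_of_left {ρl ul : ℝ} (h : ρl = 0) (X Y : ℝ → ℝ) (t : ℝ) :
    innerMass ρl ul X Y t = 0 := by
  unfold innerMass
  split_ifs
  exacts [h, rfl]

end RadialEuler

end

theorem mainTheorem1 (n : ℕ) (hn : 1 ≤ n) (R : ℝ) (hR : 0 < R)
    (ρl ρr ul ur : ℝ) (hρl : 0 ≤ ρl) (hρr : 0 ≤ ρr) :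
    ∃ S : RadialEuler.ShadowWave,
      S.IsRadialSolution n R ∧
      S.HasInitialData R (RadialEuler.initialDensity n R ρl ρr)
        (RadialEuler.initialVelocity R ul ur) ∧
      S.IsPhysical ∧
      S.IsDissipative n R ∧
      ∀ t : ℝ, 0 < t → S.ConsistsOfAtMost n R 1 3 t := by
  open RadialEuler in
  rcases lt_trichotomy ul ur with hu | hu | hu
  · have hin : ∀ t : ℝ, 0 < t →
        innerMass ρl ul (fun t => R + ur * t) (fun t => R + ul * t) t = 0 := fun t ht => by
      refine if_neg fun h => ?_
      have := mul_lt_mul_of_pos_right hu ht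
      linarith [h.1]
    -- The states separate: the front bounds the right state, and a vacuum opens between `R + ul *
    -- t` and `R + ur * t`.
    refine (masslessFront R ρl ρr ul ur ur (fun t => R + ul * t) ∅ le_rfl (Or.inr ⟨rfl, hu⟩)
      (fun t _ => by linarith) (fun j t ht => by rw [momentFlux, hin t ht]; ring)).exists_solution
      n hR hρl hρr fun t ht => Or.inr ⟨Or.inr (Finset.notMem_empty t), Or.inl (hin t ht),
        Or.inr fun _ => rfl⟩
  · subst hu
    exact (masslessFront R ρl ρr ul ul ul (fun t => R + ul * t) ∅ le_rfl (Or.inl ⟨rfl, le_rfl⟩)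
      (fun t _ => by linarith) (fun j t ht => by rw [momentFlux]; ring)).exists_solution
      n hR hρl hρr fun t ht => Or.inr ⟨Or.inr (Finset.notMem_empty t), Or.inr fun _ => rfl,
        Or.inr fun _ => rfl⟩
  · have hd : 0 < ul - ur := sub_pos.2 hu
    rcases hρl.eq_or_lt with hl | hl
    -- No matter inside: the front is the edge of the right state. It meets the line `ul * t` at the
    -- listed time, which is harmless because the left density is zero.
    · refine (masslessFront R ρl ρr ul ur ur (fun t => R + ur * t) {R / (ul - ur)} le_rfl
        (Or.inl ⟨rfl, hu.le⟩) (fun t ht h => ht ?_) (fun j t ht => ?_)).exists_solution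
        n hR hρl hρr fun t ht => Or.inr ⟨Or.inl hl.symm,
          Or.inl (innerMass_eq_zero_of_left hl.symm _ _ _), Or.inr fun _ => rfl⟩
      · rw [Finset.mem_singleton, eq_div_iff hd.ne']
        linarith
      · rw [momentFlux, innerMass_eq_zero_of_left hl.symm]
        ring
    rcases hρr.eq_or_lt with hr | hr
    · refine (masslessFront R ρl ρr ul ur ul (fun t => R + ul * t) ∅ hu.le
        (Or.inl ⟨rfl, le_rfl⟩) (fun t _ => by linarith) (fun j t ht => ?_)).exists_solution
        n hR hρl hρr fun t ht => Or.inr ⟨Or.inr (Finset.notMem_empty t), Or.inr fun _ => rfl,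
          Or.inl hr.symm⟩
      rw [momentFlux, ← hr]
      ring
    -- Here `a` and `b` are the square roots of the two densities, which weight the velocities in
    -- the early phase.
    have h := (deltaFront hR (Real.sqrt_pos.2 hl) (Real.sqrt_pos.2 hr) hd).exists_solution n hR
      (sq_nonneg _) (sq_nonneg _) fun t ht => Or.inl (deltaMass_pos hR (Real.sqrt_pos.2 hl)
        (Real.sqrt_pos.2 hr) hd ht)
    rwa [Real.sq_sqrt hρl, Real.sq_sqrt hρr] at h
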